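/- Let $m_1,m_2,n\ge 0$ be integers, let $A_1\in\mathbb C^{m_1\times m_1}$ and $A_2\in\mathbb C^{m_2\times m_2}$ be Hermitian, and let $B_1\in\mathbb C^{m_1\times n}$, $B_2\in\mathbb C^{m_2\times n}$. Write $r(\cdot)$ for rank, $\mathscr R(\cdot)$ for column space, and $i_+(\cdot)$, $i_-(\cdot)$ for the numbers of positive and negative eigenvalues (with multiplicity) of a Hermitian matrix; $P\succcurlyeq Q$ (resp. $P\succ Q$) means that $P-Q$ is Hermitian positive semidefinite (resp. positive definite). Put $$M=\begin{bmatrix}A_1&0&B_1\\0&-A_2&B_2\\B_1^*&B_2^*&0\end{bmatrix},\quad M_1=\begin{bmatrix}A_1&B_1\\B_1^*&0\end{bmatrix},\quad N=\begin{bmatrix}A_1&B_1&0\\B_1^*&0&B_2^*\end{bmatrix},$$ $$\mathcal T_1=\{X\in\mathbb C^{n\times n}: X=X^*,\ B_2XB_2^*\succcurlyeq A_2\}.$$ Then $\mathcal T_1\neq\emptyset$ if and only if $i_-\begin{bmatrix}A_2&B_2\\B_2^*&0\end{bmatrix}=r[A_2,B_2]$. Assume $\mathcal T_1\ne\emptyset$.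 Then the following maxima and minima are attained and have the stated values: $$\max_{X\in\mathcal T_1} r(A_1-B_1XB_1^*)=r[A_1,B_1],\qquad \min_{X\in\mathcal T_1} r(A_1-B_1XB_1^*)=2r[A_1,B_1]+i_-(M)-i_-(M_1)-r(N),$$ $$\max_{X\in\mathcal T_1} i_+(A_1-B_1XB_1^*)=i_+(M)-r[A_2,B_2],\qquad \min_{X\in\mathcal T_1} i_+(A_1-B_1XB_1^*)=r[A_1,B_1]-i_-(M_1),$$ $$\max_{X\in\mathcal T_1} i_-(A_1-B_1XB_1^*)=i_-(M_1),\qquad \min_{X\in\mathcal T_1} i_-(A_1-B_1XB_1^*)=r[A_1,B_1]-r(N)+i_-(M).$$ Moreover: (a) There is $X\in\mathcal T_1$ with $A_1-B_1XB_1^*$ nonsingular if and only if $r[A_1,B_1]=m_1$. (b) $A_1-B_1XB_1^*$ is nonsingular for every $X\in\mathcal T_1$ if and only if $r[A_1,B_1]=m_1$ and $i_-(M)=i_-(M_1)+r(N)-m_1$. (c) There is $X\in\mathcal T_1$ with $B_1XB_1^*=A_1$ if and only if $\mathscr R(A_1)\subseteq\mathscr R(B_1)$ and $i_-(M)=r\begin{bmatrix}B_1\\B_2\end{bmatrix}$.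 (d) There is $X\in\mathcal T_1$ with $B_1XB_1^*\prec A_1$ if and only if $i_+(M)=r[A_2,B_2]+m_1$. (e) There is $X\in\mathcal T_1$ with $B_1XB_1^*\succ A_1$ if and only if $i_-(M_1)=m_1$. (f) There is $X\in\mathcal T_1$ with $B_1XB_1^*\preccurlyeq A_1$ if and only if $i_-(M)=r(N)-r[A_1,B_1]$. (g) There is $X\in\mathcal T_1$ with $B_1XB_1^*\succcurlyeq A_1$ if and only if $i_-(M_1)=r[A_1,B_1]$. (h) $\mathcal T_1\subseteq\{X=X^*: B_1XB_1^*\succcurlyeq A_1\}$ if and only if $i_+(M)=r[A_2,B_2]$. (i) $r(A_1-B_1XB_1^*)$ is the same for all $X\in\mathcal T_1$ if and only if $i_-(M)=i_-(M_1)+r(N)-r[A_1,B_1]$. (j) $i_+(A_1-B_1XB_1^*)$ is the same for all $X\in\mathcal T_1$ if and only if $i_+(M)+i_-(M_1)=r[A_1,B_1]+r[A_2,B_2]$. (k) $i_-(A_1-B_1XB_1^*)$ is the same for all $X\in\mathcal T_1$ if and only if $i_-(M_1)+r(N)=r[A_1,B_1]+i_-(M)$. (l) For $j=1,2$, a Hermitian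 $X_j$ with $B_jX_jB_j^*=A_j$ exists if and only if $\mathscr R(A_j)\subseteq\mathscr R(B_j)$. If such $X_1$ and $X_2$ both exist, then $$\max_{X\in\mathcal T_1} r(A_1-B_1XB_1^*)=r(B_1),\qquad \min_{X\in\mathcal T_1} r(A_1-B_1XB_1^*)=i_-(M)-r\begin{bmatrix}B_1\\B_2\end{bmatrix},$$ $$\max_{X\in\mathcal T_1} i_+(A_1-B_1XB_1^*)=i_+(M)-r(B_2),\qquad \min_{X\in\mathcal T_1} i_+(A_1-B_1XB_1^*)=0,$$ $$\max_{X\in\mathcal T_1} i_-(A_1-B_1XB_1^*)=r(B_1),\qquad \min_{X\in\mathcal T_1} i_-(A_1-B_1XB_1^*)=i_-(M)-r\begin{bmatrix}B_1\\B_2\end{bmatrix}.$$ -/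

import Mathlib

open scoped Matrix ComplexOrder

noncomputable section

namespace HermLMI

open Classical in
/-- `i₊(A)`: the number of positive eigenvalues of `A`, counted with multiplicity, that is, the
number of roots of the characteristic polynomial that are real and positive (the partial order on
`ℂ` is `z < w ↔ z.re < w.re ∧ z.im = w.im`). It is applied to Hermitian matrices only. -/
def posInertia {ι : Type*} [Fintype ι] [DecidableEq ι] (A : Matrix ι ι ℂ) : ℕ :=
  A.charpoly.roots.countP (fun z => 0 < z)

open Classical in
/-- `i₋(A)`: the number of negative eigenvalues of `A`, counted with multiplicity. -/
def negInertia {ι : Type*} [Fintype ι] [DecidableEq ι] (A : Matrix ι ι ℂ) : ℕ :=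
  A.charpoly.roots.countP (fun z => z < 0)

/-- For a Hermitian matrix, `i₊` counts the indices of positive eigenvalues. -/
theorem posInertia_eq_card {ι : Type*} [Fintype ι] [DecidableEq ι] {A : Matrix ι ι ℂ}
    (hA : A.IsHermitian) :
    posInertia A = (Finset.univ.filter (fun i => 0 < hA.eigenvalues i)).card := by
  classical
  simp only [posInertia]
  rw [hA.roots_charpoly_eq_eigenvalues, Multiset.countP_map]
  simp [Finset.card_def]

/-- For a Hermitian matrix, `i₋` counts the indices of negative eigenvalues. -/
theorem negInertia_eq_card {ι : Type*} [Fintype ι] [DecidableEq ι] {A : Matrix ι ι ℂ}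
    (hA : A.IsHermitian) :
    negInertia A = (Finset.univ.filter (fun i => hA.eigenvalues i < 0)).card := by
  classical
  simp only [negInertia]
  rw [hA.roots_charpoly_eq_eigenvalues, Multiset.countP_map]
  simp only [Finset.card_def, Finset.filter_val, Function.comp]
  congr 2
  ext i
  exact RCLike.ofReal_lt_zero

/-- The range (column space) of a matrix. -/
def colSpace {m n : ℕ} (A : Matrix (Fin m) (Fin n) ℂ) : Submodule ℂ (Fin m → ℂ) :=
  LinearMap.range A.mulVecLin

/-- The rank of the row block matrix `[A, B]`. -/
def rowRank {m p q : ℕ} (A : Matrix (Fin m) (Fin p) ℂ) (B : Matrix (Fin m) (Fin q) ℂ) : ℕ :=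
  (Matrix.fromCols A B).rank

/-- The rank of the column block matrix `[A; B]`. -/
def colRank {p q n : ℕ} (A : Matrix (Fin p) (Fin n) ℂ) (B : Matrix (Fin q) (Fin n) ℂ) : ℕ :=
  (Matrix.fromRows A B).rank

/-- The Hermitian solutions `X` of the linear matrix inequality `B X Bᴴ ≽ A`. -/
def lmiSol {m n : ℕ} (A : Matrix (Fin m) (Fin m) ℂ) (B : Matrix (Fin m) (Fin n) ℂ) :
    Set (Matrix (Fin n) (Fin n) ℂ) :=
  {X | X.IsHermitian ∧ (B * X * Bᴴ - A).PosSemidef}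

/-- The matrix-valued function `X ↦ A - B X Bᴴ`. -/
def resid {m n : ℕ} (A : Matrix (Fin m) (Fin m) ℂ) (B : Matrix (Fin m) (Fin n) ℂ)
    (X : Matrix (Fin n) (Fin n) ℂ) : Matrix (Fin m) (Fin m) ℂ :=
  A - B * X * Bᴴ

/-- The bordered matrix `[A, B; Bᴴ, 0]`. -/
def bordered {m n : ℕ} (A : Matrix (Fin m) (Fin m) ℂ) (B : Matrix (Fin m) (Fin n) ℂ) :
    Matrix (Fin m ⊕ Fin n) (Fin m ⊕ Fin n) ℂ :=
  Matrix.fromBlocks A B Bᴴ 0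

/-- `M = [A₁, 0, B₁; 0, -A₂, B₂; B₁ᴴ, B₂ᴴ, 0]`. -/
def matM {m₁ m₂ n : ℕ} (A₁ : Matrix (Fin m₁) (Fin m₁) ℂ) (A₂ : Matrix (Fin m₂) (Fin m₂) ℂ)
    (B₁ : Matrix (Fin m₁) (Fin n) ℂ) (B₂ : Matrix (Fin m₂) (Fin n) ℂ) :
    Matrix ((Fin m₁ ⊕ Fin m₂) ⊕ Fin n) ((Fin m₁ ⊕ Fin m₂) ⊕ Fin n) ℂ :=
  Matrix.fromBlocks (Matrix.fromBlocks A₁ 0 0 (-A₂)) (Matrix.fromRows B₁ B₂)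
    (Matrix.fromCols B₁ᴴ B₂ᴴ) 0

/-- `N = [A₁, B₁, 0; B₁ᴴ, 0, B₂ᴴ]`. -/
def matN {m₁ m₂ n : ℕ} (A₁ : Matrix (Fin m₁) (Fin m₁) ℂ)
    (B₁ : Matrix (Fin m₁) (Fin n) ℂ) (B₂ : Matrix (Fin m₂) (Fin n) ℂ) :
    Matrix (Fin m₁ ⊕ Fin n) ((Fin m₁ ⊕ Fin n) ⊕ Fin m₂) ℂ :=
  Matrix.fromCols (Matrix.fromBlocks A₁ B₁ B₁ᴴ 0) (Matrix.fromRows 0 B₂ᴴ)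

/-- `f` attains its maximum over the set `S`, and the maximum is `v`. -/
def IsMaxVal {α : Type*} (S : Set α) (f : α → ℕ) (v : ℤ) : Prop :=
  IsGreatest ((fun X => (f X : ℤ)) '' S) v

/-- `f` attains its minimum over the set `S`, and the minimum is `v`. -/
def IsMinVal {α : Type*} (S : Set α) (f : α → ℕ) (v : ℤ) : Prop :=
  IsLeast ((fun X => (f X : ℤ)) '' S) v

end HermLMI

end

noncomputable section

namespace HermLMI

open Matrix Module

set_option linter.unusedSectionVars false

/-! ### Inertia measured by subspaces on which the form is definite -/

section Inertia

variable {ι κ : Type*} [Fintype ι] [Fintype κ]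

/-! Write R(X) = A₁ - B₁XB₁ᴴ. Everything follows from six relations valid for every solution X and
from three particular solutions. The relations are i₊(R) + i₋(R) = r(R), r(R) ≤ r[A₁,B₁], i₋(R) ≤
i₋(M₁), r[A₁,B₁] ≤ i₊(R) + i₋(M₁), i₊(R) + r[A₂,B₂] ≤ i₊(M) and i₋(M) + r[A₁,B₁] ≤ i₋(R) + r(N).
Each inertia bound compares dimensions of definite subspaces. A shift of the last coordinate absorbs
X (`hform_bordered_shift`, `hform_matM_shift`): the form of M at (u,v,w) becomes R(u) + P(v) + 2
Re⟨B₁ᴴu + B₂ᴴv, w⟩ with P = B₂XB₂ᴴ - A₂ ≽ 0. Suitable subspaces of these coordinates are then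
compared with the form of R through `posInertia_transfer`.

Extremal solutions: (1) `exists_max_neg` adds a large multiple of the identity, which keeps the
constraint and raises i₋(R) to i₋(M₁); the relations then force i₊ to be least and the rank
greatest.

(2) `exists_max_pos_min_neg` first shrinks P until its range meets that of B₂ only in 0. Let F be
the projector onto ker B₂. Adding FL + LᴴF or -tF to X leaves P unchanged. L is chosen to turn the
kernel of a compression of R into a genuine kernel as far as possible, and a large t gives the
largest i₊. Counting the kernels of M and N shows that i₋ is least.

(3) `exists_min_rank` starts from (2) and subtracts B₁HB₁ᴴ with H ≽ 0, a Schur complement step that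
removes positive directions of R whose image lies in the range of B₁, without raising i₋. Both
inertias reach their minima together, so the rank does too.

With these in hand, all claims are integer arithmetic. -/

/-- The real part of the standard Hermitian inner product. -/
def rip (x y : ι → ℂ) : ℝ := (star x ⬝ᵥ y).re

/-- The real quadratic form `x ↦ Re (xᴴ A x)`. -/
def hform (A : Matrix ι ι ℂ) (x : ι → ℂ) : ℝ := rip x (A *ᵥ x)

lemma rip_comm (x y : ι → ℂ) : rip x y = rip y x := by
  simp only [rip, dotProduct, Complex.re_sum, Pi.star_apply]
  refine Finset.sum_congr rfl fun i _ => ?_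
  simp [Complex.mul_re]; ring

@[simp] lemma rip_add_right (x y z : ι → ℂ) : rip x (y + z) = rip x y + rip x z := by
  simp [rip, dotProduct_add]

@[simp] lemma rip_add_left (x y z : ι → ℂ) : rip (x + y) z = rip x z + rip y z := by
  simp [rip, add_dotProduct]

@[simp] lemma rip_neg_right (x y : ι → ℂ) : rip x (-y) = -rip x y := by simp [rip]

@[simp] lemma rip_neg_left (x y : ι → ℂ) : rip (-x) y = -rip x y := by simp [rip]

@[simp] lemma rip_sub_right (x y z : ι → ℂ) : rip x (y - z) = rip x y - rip x z := by
  simp [rip, dotProduct_sub]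

@[simp] lemma rip_sub_left (x y z : ι → ℂ) : rip (x - y) z = rip x z - rip y z := by
  simp [rip, sub_dotProduct]

@[simp] lemma rip_zero_right (x : ι → ℂ) : rip x 0 = 0 := by simp [rip]

@[simp] lemma rip_zero_left (x : ι → ℂ) : rip 0 x = 0 := by simp [rip]

@[simp] lemma rip_smul_right (x y : ι → ℂ) (t : ℝ) : rip x ((t : ℂ) • y) = t * rip x y := by
  simp [rip, dotProduct_smul]

@[simp] lemma rip_smul_left (x y : ι → ℂ) (t : ℝ) : rip ((t : ℂ) • x) y = t * rip x y := by
  rw [rip_comm, rip_smul_right, rip_comm]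

lemma rip_mulVec (A : Matrix ι κ ℂ) (x : ι → ℂ) (y : κ → ℂ) :
    rip x (A *ᵥ y) = rip (Aᴴ *ᵥ x) y := by
  simp [rip, star_mulVec, dotProduct_mulVec]

lemma rip_self (x : ι → ℂ) : rip x x = ∑ i, Complex.normSq (x i) := by
  simp only [rip, dotProduct, Complex.re_sum, Pi.star_apply]
  refine Finset.sum_congr rfl fun i _ => ?_
  simp [Complex.normSq_apply]

lemma rip_self_nonneg (x : ι → ℂ) : 0 ≤ rip x x := by
  rw [rip_self]; exact Finset.sum_nonneg fun i _ => Complex.normSq_nonneg _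

lemma rip_self_eq_zero {x : ι → ℂ} : rip x x = 0 ↔ x = 0 := by
  rw [rip_self, Finset.sum_eq_zero_iff_of_nonneg fun i _ => Complex.normSq_nonneg _]
  simp [funext_iff]

lemma rip_self_pos {x : ι → ℂ} (hx : x ≠ 0) : 0 < rip x x :=
  lt_of_le_of_ne (rip_self_nonneg x) fun h => hx (rip_self_eq_zero.1 h.symm)

@[simp] lemma hform_zero (A : Matrix ι ι ℂ) : hform A 0 = 0 := by simp [hform]

@[simp] lemma hform_neg (A : Matrix ι ι ℂ) (x : ι → ℂ) : hform (-A) x = -hform A x := by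
  simp [hform, neg_mulVec]

lemma hform_add {A : Matrix ι ι ℂ} (hA : A.IsHermitian) (x y : ι → ℂ) :
    hform A (x + y) = hform A x + hform A y + 2 * rip x (A *ᵥ y) := by
  have : rip y (A *ᵥ x) = rip x (A *ᵥ y) := by rw [rip_mulVec, hA.eq, rip_comm]
  simp only [hform, mulVec_add, rip_add_right, rip_add_left, this]; ring

lemma im_dotProduct_mulVec {A : Matrix ι ι ℂ} (hA : A.IsHermitian) (x : ι → ℂ) :
    (star x ⬝ᵥ A *ᵥ x).im = 0 := by
  have h : star (star x ⬝ᵥ A *ᵥ x) = star x ⬝ᵥ A *ᵥ x := by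
    rw [← star_dotProduct_star, star_star, star_mulVec, hA.eq, dotProduct_comm,
      dotProduct_mulVec, dotProduct_comm]
  have := congrArg Complex.im h
  simp at this
  linarith

lemma posSemidef_iff_hform {A : Matrix ι ι ℂ} (hA : A.IsHermitian) :
    A.PosSemidef ↔ ∀ x, 0 ≤ hform A x := by
  rw [posSemidef_iff_dotProduct_mulVec]
  refine ⟨fun h x => (Complex.le_def.1 (h.2 x)).1, fun h => ⟨hA, fun x => ?_⟩⟩
  exact Complex.le_def.2 ⟨h x, (im_dotProduct_mulVec hA x).symm⟩

lemma posDef_iff_hform {A : Matrix ι ι ℂ} (hA : A.IsHermitian) :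
    A.PosDef ↔ ∀ x, x ≠ 0 → 0 < hform A x := by
  rw [posDef_iff_dotProduct_mulVec]
  refine ⟨fun h x hx => (Complex.lt_def.1 (h.2 hx)).1, fun h => ⟨hA, fun {x} hx => ?_⟩⟩
  exact Complex.lt_def.2 ⟨h x hx, (im_dotProduct_mulVec hA x).symm⟩

variable [DecidableEq ι] [DecidableEq κ]

/-- The eigenvectors with index in `p` embed a coordinate space isometrically and
diagonalise `A`. -/
lemma exists_eigen_embedding {A : Matrix ι ι ℂ} (hA : A.IsHermitian) (p : ι → Prop)
    [DecidablePred p] :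
    ∃ φ : ({i // p i} → ℂ) →ₗ[ℂ] (ι → ℂ),
      (∀ y, A *ᵥ φ y = φ (fun i => (hA.eigenvalues i : ℂ) * y i)) ∧
      ∀ y z, rip (φ y) (φ z) = rip y z := by
  set U : Matrix ι ι ℂ := ↑hA.eigenvectorUnitary with hU
  have hUU : Uᴴ * U = 1 := by
    have := (Matrix.mem_unitaryGroup_iff').1 hA.eigenvectorUnitary.2
    simpa [star_eq_conjTranspose] using this
  have hAU : A * U = U * diagonal (fun i => (hA.eigenvalues i : ℂ)) := by
    ext i j
    have := congrFun (hA.mulVec_eigenvectorBasis j) i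
    simp only [Matrix.mul_diagonal]
    simp only [Matrix.mul_apply, hU, hA.eigenvectorUnitary_apply]
    simpa [mulVec, dotProduct, mul_comm] using this
  set V : Matrix ι {i // p i} ℂ := U.submatrix id Subtype.val with hV
  have hVV : Vᴴ * V = 1 := by
    have : Vᴴ * V = (Uᴴ * U).submatrix Subtype.val Subtype.val := by
      ext i j; simp [V, Matrix.mul_apply]
    rw [this, hUU]
    ext i j; simp [Matrix.one_apply, Subtype.ext_iff]
  have hAV : A * V = V * diagonal (fun i : {i // p i} => (hA.eigenvalues i : ℂ)) := by
    ext i j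
    have := congrFun (congrFun hAU i) j
    simp only [Matrix.mul_diagonal] at this ⊢
    simpa [V, Matrix.mul_apply] using this
  refine ⟨V.mulVecLin, fun y => ?_, fun y z => ?_⟩
  · simp only [mulVecLin_apply, mulVec_mulVec, hAV]
    rw [← mulVec_mulVec]
    congr 1
    ext i; simp [mulVec_diagonal]
  · simp only [mulVecLin_apply]
    rw [rip_mulVec, mulVec_mulVec, hVV, one_mulVec]

/-- In eigenvector coordinates the norm and the form are both diagonal, so the signs of the selected
eigenvalues decide the sign of the form on W. The last clause turns an isotropic vector of a
semidefinite piece into a kernel vector, which `rank_fromCols_le` needs. -/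
lemma exists_eigen_subspace {A : Matrix ι ι ℂ} (hA : A.IsHermitian) (p : ι → Prop)
    [DecidablePred p] :
    ∃ W : Submodule ℂ (ι → ℂ), finrank ℂ W = (Finset.univ.filter p).card ∧
      ∀ x ∈ W, ∃ y : {i // p i} → ℂ, rip x x = ∑ i : {i // p i}, Complex.normSq (y i) ∧
        hform A x = ∑ i : {i // p i}, hA.eigenvalues i * Complex.normSq (y i) ∧
        ((∀ i : {i // p i}, hA.eigenvalues i * Complex.normSq (y i) = 0) → A *ᵥ x = 0) := by
  obtain ⟨φ, h1, h2⟩ := exists_eigen_embedding hA p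
  have hφ : Function.Injective φ := by
    rw [injective_iff_map_eq_zero]
    intro y hy
    rw [← rip_self_eq_zero, ← h2, hy, rip_zero_left]
  refine ⟨LinearMap.range φ, ?_, ?_⟩
  · rw [LinearMap.finrank_range_of_inj hφ, finrank_fintype_fun_eq_card, Fintype.card_subtype]
  · rintro _ ⟨y, rfl⟩
    refine ⟨y, by rw [h2, rip_self], ?_, fun h => ?_⟩
    · rw [hform, h1, h2]
      simp only [rip, dotProduct, Complex.re_sum, Pi.star_apply]
      refine Finset.sum_congr rfl fun i _ => ?_
      simp [Complex.normSq_apply]; ring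
    · rw [h1]
      convert map_zero φ using 2
      funext i
      have := h i
      simp at this
      simpa using this

/-- A subspace of maximal dimension on which the form is uniformly positive definite. -/
lemma exists_pos_subspace {A : Matrix ι ι ℂ} (hA : A.IsHermitian) :
    ∃ W : Submodule ℂ (ι → ℂ), finrank ℂ W = posInertia A ∧
      ∃ δ : ℝ, 0 < δ ∧ ∀ x ∈ W, δ * rip x x ≤ hform A x := by
  obtain ⟨W, hW, h⟩ := exists_eigen_subspace hA (fun i => 0 < hA.eigenvalues i)
  have : ∃ δ : ℝ, 0 < δ ∧ ∀ i, 0 < hA.eigenvalues i → δ ≤ hA.eigenvalues i := by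
    by_cases hne : (Finset.univ.filter (fun i => 0 < hA.eigenvalues i)).Nonempty
    · obtain ⟨i, hi, hmin⟩ := Finset.exists_min_image _ hA.eigenvalues hne
      exact ⟨_, (Finset.mem_filter.1 hi).2, fun j hj => hmin j (by simpa using hj)⟩
    -- With no positive eigenvalue the condition is empty and any δ serves.
    · refine ⟨1, one_pos, fun i hi => (hne ⟨i, by simpa using hi⟩).elim⟩
  obtain ⟨δ, hδ, hmin⟩ := this
  refine ⟨W, by rw [hW, posInertia_eq_card hA], δ, hδ, fun x hx => ?_⟩
  obtain ⟨y, h1, h2, -⟩ := h x hx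
  rw [h1, h2, Finset.mul_sum]
  exact Finset.sum_le_sum fun i _ =>
    mul_le_mul_of_nonneg_right (hmin _ i.2) (Complex.normSq_nonneg _)

/-- A subspace of dimension `card ι - i₊(A)` on which the form is nonpositive. -/
lemma exists_nonpos_subspace {A : Matrix ι ι ℂ} (hA : A.IsHermitian) :
    ∃ W : Submodule ℂ (ι → ℂ), finrank ℂ W + posInertia A = Fintype.card ι ∧
      ∀ x ∈ W, hform A x ≤ 0 ∧ (hform A x = 0 → A *ᵥ x = 0) := by
  obtain ⟨W, hW, h⟩ := exists_eigen_subspace hA (fun i => ¬ 0 < hA.eigenvalues i)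
  refine ⟨W, ?_, fun x hx => ?_⟩
  · rw [hW, posInertia_eq_card hA, add_comm, Finset.card_filter_add_card_filter_not,
      Finset.card_univ]
  · obtain ⟨y, -, h2, h3⟩ := h x hx
    have hle : ∀ i : {i // ¬ 0 < hA.eigenvalues i},
        hA.eigenvalues i * Complex.normSq (y i) ≤ 0 := fun i =>
      mul_nonpos_of_nonpos_of_nonneg (not_lt.1 i.2) (Complex.normSq_nonneg _)
    refine ⟨by rw [h2]; exact Finset.sum_nonpos fun i _ => hle i, fun h0 => h3 fun i => ?_⟩
    rw [h2, Finset.sum_eq_zero_iff_of_nonpos fun i _ => hle i] at h0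
    exact h0 i (Finset.mem_univ i)

/-- The form of a Hermitian matrix is positive definite on `W` only if `dim W ≤ i₊(A)`. -/
lemma finrank_le_posInertia {A : Matrix ι ι ℂ} (hA : A.IsHermitian)
    {W : Submodule ℂ (ι → ℂ)} (hW : ∀ x ∈ W, x ≠ 0 → 0 < hform A x) :
    finrank ℂ W ≤ posInertia A := by
  obtain ⟨W', hd, h⟩ := exists_nonpos_subspace hA
  have hdis : Disjoint W W' := by
    rw [Submodule.disjoint_def]
    intro x hx hx'
    by_contra hne
    exact absurd (hW x hx hne) (not_lt.2 (h x hx').1)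
  have := Submodule.finrank_add_finrank_le_of_disjoint hdis
  rw [finrank_fintype_fun_eq_card] at this
  omega

/-- Eigenvectors of negative eigenvalues span a positive subspace of -A, and conversely a positive
subspace of -A meets the span of the other eigenvectors only in 0. This lets bounds on i₋ be proved
as bounds on i₊ of the negated matrix. -/
lemma negInertia_eq_posInertia_neg {A : Matrix ι ι ℂ} (hA : A.IsHermitian) :
    negInertia A = posInertia (-A) := by
  apply le_antisymm
  · obtain ⟨W, hW, h⟩ := exists_eigen_subspace hA (fun i => hA.eigenvalues i < 0)
    rw [negInertia_eq_card hA, ← hW]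
    refine finrank_le_posInertia hA.neg fun x hx hne => ?_
    obtain ⟨y, h1, h2, -⟩ := h x hx
    rw [hform_neg, h2, neg_pos]
    have hle : ∀ i : {i // hA.eigenvalues i < 0},
        hA.eigenvalues i * Complex.normSq (y i) ≤ 0 := fun i =>
      mul_nonpos_of_nonpos_of_nonneg i.2.le (Complex.normSq_nonneg _)
    refine lt_of_le_of_ne (Finset.sum_nonpos fun i _ => hle i) fun h0 => hne ?_
    rw [Finset.sum_eq_zero_iff_of_nonpos fun i _ => hle i] at h0
    rw [← rip_self_eq_zero, h1]
    refine Finset.sum_eq_zero fun i hi => ?_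
    exact (mul_eq_zero.1 (h0 i hi)).resolve_left i.2.ne
  · obtain ⟨W, hW, h⟩ := exists_eigen_subspace hA (fun i => ¬ hA.eigenvalues i < 0)
    obtain ⟨W', hW', δ, hδ, h'⟩ := exists_pos_subspace hA.neg
    have hdis : Disjoint W' W := by
      rw [Submodule.disjoint_def]
      intro x hx' hx
      obtain ⟨y, -, h2, -⟩ := h x hx
      have hx0 : 0 ≤ hform A x := by
        rw [h2]
        exact Finset.sum_nonneg fun i _ => mul_nonneg (not_lt.1 i.2) (Complex.normSq_nonneg _)
      by_contra hne
      have := h' x hx'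
      rw [hform_neg] at this
      nlinarith [rip_self_pos hne]
    have := Submodule.finrank_add_finrank_le_of_disjoint hdis
    rw [finrank_fintype_fun_eq_card, hW, hW'] at this
    have h2 := Finset.card_filter_add_card_filter_not (s := (Finset.univ : Finset ι))
      (fun i => hA.eigenvalues i < 0)
    rw [Finset.card_univ] at h2
    rw [negInertia_eq_card hA]
    omega

lemma posInertia_add_negInertia {A : Matrix ι ι ℂ} (hA : A.IsHermitian) :
    posInertia A + negInertia A = A.rank := by
  rw [posInertia_eq_card hA, negInertia_eq_card hA, hA.rank_eq_card_non_zero_eigs,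
    Fintype.card_subtype, ← Finset.card_union_of_disjoint]
  · congr 1
    ext i
    simp [lt_or_lt_iff_ne, ne_comm]
  · rw [Finset.disjoint_filter]
    intro i _ h1 h2
    exact lt_asymm h1 h2

lemma finrank_add_le_finrank_comap {E V : Type*} [AddCommGroup E] [Module ℂ E]
    [FiniteDimensional ℂ E] [AddCommGroup V] [Module ℂ V] [FiniteDimensional ℂ V]
    (g : E →ₗ[ℂ] V) (W : Submodule ℂ V) :
    finrank ℂ E + finrank ℂ W ≤ finrank ℂ (W.comap g) + finrank ℂ V := by
  have h1 := LinearMap.finrank_range_add_finrank_ker (W.mkQ ∘ₗ g)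
  rw [LinearMap.ker_comp, Submodule.ker_mkQ] at h1
  have h2 := W.finrank_quotient_add_finrank
  have h3 := Submodule.finrank_le (LinearMap.range (W.mkQ ∘ₗ g))
  omega

lemma finrank_le_posInertia_of_map {C : Matrix κ κ ℂ} (hC : C.IsHermitian) {E : Type*}
    [AddCommGroup E] [Module ℂ E] [FiniteDimensional ℂ E] (f : E →ₗ[ℂ] (κ → ℂ))
    (h : ∀ e, e ≠ 0 → 0 < hform C (f e)) : finrank ℂ E ≤ posInertia C := by
  have hf : Function.Injective f := by
    rw [injective_iff_map_eq_zero]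
    intro e he
    by_contra hne
    have := h e hne
    rw [he, hform_zero] at this
    exact lt_irrefl _ this
  rw [← LinearMap.finrank_range_of_inj hf]
  refine finrank_le_posInertia hC ?_
  rintro _ ⟨e, rfl⟩ hne
  exact h e fun h0 => hne (by rw [h0, map_zero])

/-- Comparison of positive inertias along a space `E` mapping to both form spaces. -/
lemma posInertia_transfer {A : Matrix ι ι ℂ} {C : Matrix κ κ ℂ} (hA : A.IsHermitian)
    (hC : C.IsHermitian) {E : Type*} [AddCommGroup E] [Module ℂ E] [FiniteDimensional ℂ E]
    (g : E →ₗ[ℂ] (ι → ℂ)) (f : E →ₗ[ℂ] (κ → ℂ)) (hg : Function.Injective g)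
    (h : ∀ e, 0 < hform A (g e) → 0 < hform C (f e)) :
    posInertia A + finrank ℂ E ≤ posInertia C + Fintype.card ι := by
  obtain ⟨W, hW, δ, hδ, hp⟩ := exists_pos_subspace hA
  have hpos : ∀ e ∈ W.comap g, e ≠ 0 → 0 < hform C (f e) := fun e he hne => by
    refine h e (lt_of_lt_of_le (mul_pos hδ (rip_self_pos ?_)) (hp _ he))
    rwa [Ne, map_eq_zero_iff g hg]
  -- Pulling W back along the injection g loses at most the codimension of g(E), and C is positive
  -- on the f-image of what remains.
  have h1 := finrank_add_le_finrank_comap g W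
  rw [finrank_fintype_fun_eq_card, hW] at h1
  have h2 := finrank_le_posInertia_of_map hC (f.domRestrict (W.comap g))
    fun e hne => hpos e e.2 (by simpa using hne)
  omega

end Inertia

/-! ### Bordered matrices and the bounds without constraint -/

section General

variable {ι κ : Type*} [Fintype ι] [Fintype κ]

lemma rip_elim (u u' : ι → ℂ) (w w' : κ → ℂ) :
    rip (Sum.elim u w) (Sum.elim u' w') = rip u u' + rip w w' := by
  simp [rip, dotProduct, Fintype.sum_sum_type]

lemma rip_self_sub_nonneg (x y : ι → ℂ) : 2 * rip x y ≤ rip x x + rip y y := by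
  have := rip_self_nonneg (x - y)
  simp only [rip_sub_left, rip_sub_right, rip_comm y x] at this
  linarith

/-- The linear map into functions on a sum type with the given components. -/
def elimL {E : Type*} [AddCommGroup E] [Module ℂ E] (f : E →ₗ[ℂ] (ι → ℂ)) (g : E →ₗ[ℂ] (κ → ℂ)) :
    E →ₗ[ℂ] (ι ⊕ κ → ℂ) where
  toFun e := Sum.elim (f e) (g e)
  map_add' x y := by ext (i | i) <;> simp
  map_smul' c x := by ext (i | i) <;> simp

@[simp] lemma elimL_apply {E : Type*} [AddCommGroup E] [Module ℂ E] (f : E →ₗ[ℂ] (ι → ℂ))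
    (g : E →ₗ[ℂ] (κ → ℂ)) (e : E) : elimL f g e = Sum.elim (f e) (g e) := rfl

/-- The null space of a matrix. -/
def nullSpace (A : Matrix ι κ ℂ) : Submodule ℂ (κ → ℂ) := LinearMap.ker A.mulVecLin

@[simp] lemma mem_nullSpace {A : Matrix ι κ ℂ} {x : κ → ℂ} : x ∈ nullSpace A ↔ A *ᵥ x = 0 :=
  Iff.rfl

lemma rank_add_finrank_nullSpace (A : Matrix ι κ ℂ) :
    A.rank + finrank ℂ (nullSpace A) = Fintype.card κ := by
  rw [← finrank_fintype_fun_eq_card ℂ]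
  exact LinearMap.finrank_range_add_finrank_ker A.mulVecLin

lemma rank_add_finrank_nullSpace_conjTranspose (A : Matrix ι κ ℂ) :
    A.rank + finrank ℂ (nullSpace Aᴴ) = Fintype.card ι := by
  rw [← rank_conjTranspose, rank_add_finrank_nullSpace]

/-- Rank-nullity for [A, B]ᴴ, whose kernel is the common kernel of Aᴴ and Bᴴ. The row-block ranks
enter most dimension counts in this form. -/
lemma rank_fromCols_add {κ' : Type*} [Fintype κ'] (A : Matrix ι κ ℂ) (B : Matrix ι κ' ℂ) :
    (fromCols A B).rank + finrank ℂ ↥(nullSpace Aᴴ ⊓ nullSpace Bᴴ) = Fintype.card ι := by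
  rw [← rank_add_finrank_nullSpace_conjTranspose (fromCols A B)]
  suffices h : nullSpace Aᴴ ⊓ nullSpace Bᴴ = nullSpace (fromCols A B)ᴴ by rw [h]
  ext x
  rw [conjTranspose_fromCols_eq_fromRows_conjTranspose]
  simp only [Submodule.mem_inf, mem_nullSpace, fromRows_mulVec]
  constructor
  · rintro ⟨h1, h2⟩; rw [h1, h2]; ext (i | i) <;> rfl
  · intro h
    exact ⟨funext fun i => congrFun h (Sum.inl i), funext fun i => congrFun h (Sum.inr i)⟩

lemma exists_disjoint_le {V : Type*} [AddCommGroup V] [Module ℂ V] [FiniteDimensional ℂ V]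
    (W K : Submodule ℂ V) :
    ∃ S ≤ W, Disjoint S K ∧ finrank ℂ W ≤ finrank ℂ S + finrank ℂ K := by
  obtain ⟨S', hS'⟩ := K.exists_isCompl
  refine ⟨W ⊓ S', inf_le_left, (hS'.symm.disjoint).mono_left inf_le_right, ?_⟩
  have h1 := Submodule.finrank_sup_add_finrank_inf_eq W S'
  have h2 := Submodule.finrank_add_eq_of_isCompl hS'
  have h3 := Submodule.finrank_le (W ⊔ S')
  omega

variable [DecidableEq ι] [DecidableEq κ]

lemma exists_hform_le {A : Matrix ι ι ℂ} (hA : A.IsHermitian) :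
    ∃ C : ℝ, 0 < C ∧ ∀ x, hform A x ≤ C * rip x x := by
  obtain ⟨W, hW, h⟩ := exists_eigen_subspace hA (fun _ => True)
  have hT : W = ⊤ := Submodule.eq_top_of_finrank_eq (by
    rw [hW, finrank_fintype_fun_eq_card]; simp)
  refine ⟨1 + ∑ i, |hA.eigenvalues i|, by positivity, fun x => ?_⟩
  obtain ⟨y, h1, h2, -⟩ := h x (hT ▸ Submodule.mem_top)
  rw [h1, h2, Finset.mul_sum]
  refine Finset.sum_le_sum fun i _ => mul_le_mul_of_nonneg_right ?_ (Complex.normSq_nonneg _)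
  have := Finset.single_le_sum (f := fun i => |hA.eigenvalues i|) (fun i _ => abs_nonneg _)
    (Finset.mem_univ i.1)
  have h3 := le_abs_self (hA.eigenvalues i)
  linarith

lemma isHermitian_bordered {A : Matrix ι ι ℂ} (hA : A.IsHermitian) (B : Matrix ι κ ℂ) :
    (fromBlocks A B Bᴴ 0).IsHermitian :=
  IsHermitian.fromBlocks hA (by simp) isHermitian_zero

lemma hform_bordered (A : Matrix ι ι ℂ) (B : Matrix ι κ ℂ) (u : ι → ℂ) (w : κ → ℂ) :
    hform (fromBlocks A B Bᴴ 0) (Sum.elim u w) = hform A u + 2 * rip (Bᴴ *ᵥ u) w := by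
  rw [hform, fromBlocks_mulVec, rip_elim]
  simp only [Sum.elim_comp_inl, Sum.elim_comp_inr, zero_mulVec, add_zero, rip_add_right,
    hform]
  rw [rip_mulVec B, rip_comm w]; ring

lemma hform_congr_sub (A : Matrix ι ι ℂ) (B : Matrix ι κ ℂ) (X : Matrix κ κ ℂ) (u : ι → ℂ) :
    hform (A - B * X * Bᴴ) u = hform A u - rip (Bᴴ *ᵥ u) (X *ᵥ Bᴴ *ᵥ u) := by
  simp only [hform, sub_mulVec, rip_sub_right, ← mulVec_mulVec, rip_mulVec B]

/-- The shift is a congruence: its cross term with Bᴴu supplies exactly the quadratic term of X.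
Hence the bordered matrix controls all residuals at once. -/
lemma hform_bordered_shift (A : Matrix ι ι ℂ) (B : Matrix ι κ ℂ) (X : Matrix κ κ ℂ)
    (u : ι → ℂ) (w : κ → ℂ) :
    hform (fromBlocks A B Bᴴ 0) (Sum.elim u (w - ((1 / 2 : ℝ) : ℂ) • X *ᵥ Bᴴ *ᵥ u)) =
      hform (A - B * X * Bᴴ) u + 2 * rip (Bᴴ *ᵥ u) w := by
  rw [hform_bordered, hform_congr_sub, rip_sub_right, rip_smul_right]; ring

lemma isHermitian_resid {A : Matrix ι ι ℂ} {X : Matrix κ κ ℂ} (hA : A.IsHermitian)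
    (B : Matrix ι κ ℂ) (hX : X.IsHermitian) : (A - B * X * Bᴴ).IsHermitian :=
  hA.sub (isHermitian_mul_mul_conjTranspose B hX)

/-- `i₋(A - B X Bᴴ) ≤ i₋[A, B; Bᴴ, 0]`. -/
lemma negInertia_resid_le {A : Matrix ι ι ℂ} (hA : A.IsHermitian) (B : Matrix ι κ ℂ)
    {X : Matrix κ κ ℂ} (hX : X.IsHermitian) :
    negInertia (A - B * X * Bᴴ) ≤ negInertia (fromBlocks A B Bᴴ 0) := by
  have hR := isHermitian_resid hA B hX
  have hM := isHermitian_bordered hA B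
  rw [negInertia_eq_posInertia_neg hR, negInertia_eq_posInertia_neg hM]
  have := posInertia_transfer hR.neg hM.neg LinearMap.id
    (elimL LinearMap.id (-(((1 / 2 : ℝ) : ℂ) • X.mulVecLin ∘ₗ Bᴴ.mulVecLin))) Function.injective_id
    (fun u hu => by
      have h := hform_bordered_shift A B X u 0
      simp only [zero_sub, rip_zero_right, mul_zero, add_zero] at h
      rw [hform_neg] at hu ⊢
      simp only [elimL_apply, LinearMap.neg_apply, LinearMap.smul_apply, LinearMap.comp_apply,
        mulVecLin_apply, LinearMap.id_apply] at hu ⊢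
      rwa [h])
  rw [finrank_fintype_fun_eq_card] at this
  omega

/-- `r[A, B] ≤ i₊(A - B X Bᴴ) + i₋[A, B; Bᴴ, 0]`. -/
lemma rank_fromCols_le {A : Matrix ι ι ℂ} (hA : A.IsHermitian) (B : Matrix ι κ ℂ)
    {X : Matrix κ κ ℂ} (hX : X.IsHermitian) :
    (fromCols A B).rank ≤
      posInertia (A - B * X * Bᴴ) + negInertia (fromBlocks A B Bᴴ 0) := by
  have hR := isHermitian_resid hA B hX
  have hM := isHermitian_bordered hA B
  rw [negInertia_eq_posInertia_neg hM]
  obtain ⟨W, hW, hle⟩ := exists_nonpos_subspace hR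
  obtain ⟨S, hSW, hdis, hS⟩ := exists_disjoint_le W (nullSpace Aᴴ ⊓ nullSpace Bᴴ)
  have h1 := rank_fromCols_add A B
  -- Taking w = -Bᴴu before the shift makes the negated bordered form equal to 2|Bᴴu|² minus the
  -- residual at u. On S, where the residual is nonpositive, this can vanish only if u lies in the
  -- common kernel of A and Bᴴ, which S avoids.
  have h2 : finrank ℂ S ≤ _ := finrank_le_posInertia_of_map hM.neg
    ((elimL LinearMap.id (-Bᴴ.mulVecLin -
      (((1 / 2 : ℝ) : ℂ) • X.mulVecLin ∘ₗ Bᴴ.mulVecLin))).domRestrict S) (fun e hne => by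
    have h := hform_bordered_shift A B X e (-(Bᴴ *ᵥ e))
    simp only [rip_neg_right] at h
    rw [hform_neg]
    simp only [LinearMap.domRestrict_apply, elimL_apply, LinearMap.sub_apply, LinearMap.neg_apply,
      LinearMap.smul_apply, LinearMap.comp_apply, mulVecLin_apply, LinearMap.id_apply]
    rw [h]
    have hq := hle e (hSW e.2)
    by_cases hb : Bᴴ *ᵥ (e : ι → ℂ) = 0
    · rcases lt_or_eq_of_le hq.1 with hlt | heq
      · rw [hb]; simpa using hlt
      · exfalso
        have hRe := hq.2 heq
        have hAe : Aᴴ *ᵥ (e : ι → ℂ) = 0 := by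
          rw [hA.eq]
          simpa [sub_mulVec, ← mulVec_mulVec, hb] using hRe
        exact hne (Subtype.ext (Submodule.disjoint_def.1 hdis e e.2 ⟨hAe, hb⟩))
    · have := rip_self_pos hb
      linarith [hq.1])
  omega

/-- For large `t`, `A + t B Bᴴ` has as many positive eigenvalues as `[A, B; Bᴴ, 0]`. -/
lemma exists_posInertia_bordered_le {A : Matrix ι ι ℂ} (hA : A.IsHermitian) (B : Matrix ι κ ℂ) :
    ∃ t : ℝ, 0 ≤ t ∧
      posInertia (fromBlocks A B Bᴴ 0) ≤ posInertia (A - B * (((-t : ℝ) : ℂ) • (1 : Matrix κ κ ℂ)) * Bᴴ) := by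
  have hM := isHermitian_bordered hA B
  obtain ⟨W, hW, δ, hδ, h⟩ := exists_pos_subspace hM
  -- By Young's inequality 2 Re⟨b,w⟩ ≤ |b|²/δ + δ|w|². The δ|w|² is paid for by the uniform
  -- positivity on W, so t = 1/δ makes the form positive in u alone.
  refine ⟨1 / δ, by positivity, ?_⟩
  rw [← hW]
  have hX : (((-(1 / δ) : ℝ) : ℂ) • (1 : Matrix κ κ ℂ)).IsHermitian := by
    simp [IsHermitian, conjTranspose_smul]
  refine finrank_le_posInertia_of_map (isHermitian_resid hA B hX)
    ((LinearMap.funLeft ℂ ℂ Sum.inl).domRestrict W) fun e hne => ?_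
  obtain ⟨e, he⟩ := e
  have h1 := h e he
  obtain ⟨u, w, rfl⟩ : ∃ u w, e = Sum.elim u w := ⟨_, _, (Sum.elim_comp_inl_inr e).symm⟩
  have h2 : (LinearMap.funLeft ℂ ℂ Sum.inl).domRestrict W ⟨Sum.elim u w, he⟩ = u := rfl
  rw [h2, hform_congr_sub]
  rw [hform_bordered, rip_elim] at h1
  simp only [smul_mulVec, one_mulVec]
  rw [rip_smul_right]
  set b := Bᴴ *ᵥ u with hb
  have h3 := rip_self_sub_nonneg (((1 / δ : ℝ) : ℂ) • b) w
  simp only [rip_smul_left, rip_smul_right] at h3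
  have h4 : 2 * rip b w ≤ 1 / δ * rip b b + δ * rip w w := by
    have := mul_le_mul_of_nonneg_left h3 hδ.le
    field_simp at this ⊢
    linarith
  by_cases hu : u = 0
  · exfalso
    have hb0 : b = 0 := by rw [hb, hu, mulVec_zero]
    rw [hu, hb0] at h1
    simp only [rip_zero_left, hform_zero, mul_zero, zero_add] at h1
    have hw : w = 0 := by
      by_contra hw
      nlinarith [rip_self_pos hw]
    apply hne
    ext i
    rcases i with i | i <;> simp [hu, hw]
  · nlinarith [rip_self_pos hu]

end General

/-! ### Minimal solutions and reduction of the rank by a semidefinite term -/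

section Projections

variable {ι κ : Type*} [Fintype ι] [Fintype κ] [DecidableEq ι] [DecidableEq κ]

/-- The orthogonal projector onto a subspace, as a matrix. -/
lemma exists_orthogonal_projector (S : Submodule ℂ (ι → ℂ)) :
    ∃ E : Matrix ι ι ℂ, E.IsHermitian ∧ E * E = E ∧ (∀ x, E *ᵥ x ∈ S) ∧ ∀ x ∈ S, E *ᵥ x = x := by
  let e := WithLp.linearEquiv 2 ℂ (ι → ℂ)
  let S' : Submodule ℂ (EuclideanSpace ℂ ι) := S.comap e.toLinearMap
  let p : EuclideanSpace ℂ ι →ₗ[ℂ] EuclideanSpace ℂ ι := S'.starProjection.toLinearMap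
  let E : Matrix ι ι ℂ := Matrix.toEuclideanLin.symm p
  have hE : Matrix.toEuclideanLin E = p := LinearEquiv.apply_symm_apply _ _
  have hEx : ∀ x, E *ᵥ x = e (p (e.symm x)) := fun x => by
    rw [← hE]; rfl
  have hS : ∀ x, E *ᵥ x ∈ S := fun x => by
    rw [hEx]
    exact S'.starProjection_apply_mem (e.symm x)
  have hid : ∀ x ∈ S, E *ᵥ x = x := fun x hx => by
    have : p (e.symm x) = e.symm x := Submodule.starProjection_eq_self_iff.2 hx
    rw [hEx, this, LinearEquiv.apply_symm_apply]
  refine ⟨E, ?_, ?_, hS, hid⟩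
  · rw [← Matrix.isSymmetric_toEuclideanLin_iff, hE]
    exact S'.starProjection_isSymmetric
  · apply Matrix.toLin'.injective
    ext1 x
    ext1
    simp only [LinearMap.comp_apply, toLin'_apply, ← mulVec_mulVec]
    rw [hid _ (hS _)]

/-- If the columns of `G` lie in the column space of `B`, then `G = B K`. -/
lemma exists_eq_mul {m : Type*} [Fintype m] [DecidableEq m] (G : Matrix ι m ℂ) (B : Matrix ι κ ℂ)
    (h : ∀ x, ∃ w, G *ᵥ x = B *ᵥ w) : ∃ K : Matrix κ m ℂ, G = B * K := by
  choose w hw using fun j => h (Pi.single j 1)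
  refine ⟨Matrix.of fun i j => w j i, ?_⟩
  ext i j
  have := congrFun (hw j) i
  simpa [mulVec, dotProduct, Matrix.mul_apply, Pi.single_apply] using this

/-- A solution of `B X Bᴴ ≽ A` whose residual has range disjoint from that of `B`. -/
lemma exists_minimal_solution {A : Matrix ι ι ℂ} (B : Matrix ι κ ℂ)
    {X : Matrix κ κ ℂ} (hX : X.IsHermitian) (hP : (B * X * Bᴴ - A).PosSemidef) :
    ∃ X₀ : Matrix κ κ ℂ, X₀.IsHermitian ∧ (B * X₀ * Bᴴ - A).PosSemidef ∧
      ∀ y z, (B * X₀ * Bᴴ - A) *ᵥ y = B *ᵥ z → (B * X₀ * Bᴴ - A) *ᵥ y = 0 := by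
  obtain ⟨G, hG⟩ : ∃ G : Matrix ι ι ℂ, B * X * Bᴴ - A = Gᴴ * G := by
    open scoped MatrixOrder in
    exact CStarAlgebra.nonneg_iff_eq_star_mul_self.1 hP.nonneg
  -- With residual GᴴG, S holds the vectors that Gᴴ sends into the range of B. The part GᴴEG, E the
  -- projector onto S, has the form BKKᴴBᴴ and is removed by passing to X - KKᴴ. If a vector of the
  -- remaining range lies in the range of B, it is Gᴴg with g both in S and killed by E, so g = 0.
  let S : Submodule ℂ (ι → ℂ) := (LinearMap.range B.mulVecLin).comap Gᴴ.mulVecLin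
  obtain ⟨E, hEh, hEE, hES, hEid⟩ := exists_orthogonal_projector S
  obtain ⟨K, hK⟩ := exists_eq_mul (Gᴴ * E) B fun x => by
    obtain ⟨w, hw⟩ := hES x
    exact ⟨w, by rw [← mulVec_mulVec]; exact hw.symm⟩
  have hKK : B * (K * Kᴴ) * Bᴴ = Gᴴ * E * G := by
    have : (B * K) * (B * K)ᴴ = Gᴴ * E * G := by
      rw [← hK, conjTranspose_mul, hEh.eq, conjTranspose_conjTranspose]
      simp only [Matrix.mul_assoc]
      rw [← Matrix.mul_assoc E E, hEE]
    rw [← this, conjTranspose_mul]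
    simp only [Matrix.mul_assoc]
  have hres : B * (X - K * Kᴴ) * Bᴴ - A = Gᴴ * (1 - E) * G := by
    rw [Matrix.mul_sub, Matrix.sub_mul, hKK, sub_right_comm, hG, Matrix.mul_sub, Matrix.sub_mul,
      Matrix.mul_one]
  have hF : (1 - E) * (1 - E)ᴴ = 1 - E := by
    rw [(isHermitian_one.sub hEh).eq, Matrix.mul_sub, Matrix.mul_one, Matrix.sub_mul, hEE]; simp
  refine ⟨X - K * Kᴴ, hX.sub (isHermitian_mul_conjTranspose_self K), ?_, ?_⟩
  · rw [hres, ← hF]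
    have := posSemidef_conjTranspose_mul_self ((1 - E)ᴴ * G)
    rw [conjTranspose_mul, conjTranspose_conjTranspose] at this
    simpa only [Matrix.mul_assoc] using this
  · intro y z h
    rw [hres] at h ⊢
    set g := ((1 - E) * G) *ᵥ y with hg
    have hGg : (Gᴴ * (1 - E) * G) *ᵥ y = Gᴴ *ᵥ g := by
      rw [hg, mulVec_mulVec, Matrix.mul_assoc]
    rw [hGg] at h ⊢
    have hgS : g ∈ S := ⟨z, h.symm⟩
    have hEg : E *ᵥ g = 0 := by
      rw [hg, mulVec_mulVec, ← Matrix.mul_assoc, Matrix.mul_sub, hEE]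
      simp
    rw [← hEid g hgS, hEg, mulVec_zero]

lemma finrank_map_of_forall_eq_zero {V V' : Type*} [AddCommGroup V] [Module ℂ V] [AddCommGroup V']
    [Module ℂ V'] (f : V →ₗ[ℂ] V') (W : Submodule ℂ V) (h : ∀ x ∈ W, f x = 0 → x = 0) :
    finrank ℂ (W.map f) = finrank ℂ W := by
  rw [← LinearMap.range_domRestrict]
  apply LinearMap.finrank_range_of_inj
  rw [injective_iff_map_eq_zero]
  exact fun x hx => Subtype.ext (h x x.2 hx)

lemma finrank_add_le_finrank_inf {V : Type*} [AddCommGroup V] [Module ℂ V]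
    [FiniteDimensional ℂ V] (W W' : Submodule ℂ V) :
    finrank ℂ W + finrank ℂ W' ≤ finrank ℂ ↥(W ⊓ W') + finrank ℂ V := by
  have h1 := Submodule.finrank_sup_add_finrank_inf_eq W W'
  have h2 := Submodule.finrank_le (W ⊔ W')
  omega

/-- The null space of `Bᴴ` contains a negative subspace for `R` of dimension at least
`i₋[R, B; Bᴴ, 0] - r(B)`. -/
lemma exists_neg_subspace_nullSpace {R : Matrix ι ι ℂ} (hR : R.IsHermitian) (B : Matrix ι κ ℂ) :
    ∃ N ≤ nullSpace Bᴴ, (∀ x ∈ N, x ≠ 0 → hform R x < 0) ∧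
      negInertia (fromBlocks R B Bᴴ 0) ≤ finrank ℂ N + B.rank := by
  have hM := isHermitian_bordered hR B
  obtain ⟨W, hW, δ, hδ, hneg⟩ := exists_pos_subspace hM.neg
  rw [← negInertia_eq_posInertia_neg hM] at hW
  set π : (ι ⊕ κ → ℂ) →ₗ[ℂ] (ι → ℂ) := LinearMap.funLeft ℂ ℂ Sum.inl with hπ
  have key : ∀ x ∈ W ⊓ (nullSpace Bᴴ).comap π, x ≠ 0 → hform R (π x) < 0 := by
    rintro x ⟨hx, hx'⟩ hne
    obtain ⟨u, w, rfl⟩ : ∃ u w, x = Sum.elim u w := ⟨_, _, (Sum.elim_comp_inl_inr x).symm⟩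
    have h1 := hneg _ hx
    have hu : Bᴴ *ᵥ u = 0 := hx'
    have h2 := rip_self_pos hne
    rw [hform_neg, hform_bordered, hu, rip_zero_left] at h1
    change hform R u < 0
    nlinarith
  -- Where the first component is in ker Bᴴ the cross term vanishes, so the bordered form is that of
  -- R. Imposing this condition costs at most r(B) dimensions.
  refine ⟨(W ⊓ (nullSpace Bᴴ).comap π).map π, ?_, ?_, ?_⟩
  · rintro _ ⟨x, hx, rfl⟩
    exact hx.2
  · rintro _ ⟨x, hx, rfl⟩ hne
    exact key x hx fun h => hne (by rw [h, map_zero])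
  · rw [finrank_map_of_forall_eq_zero]
    · have h1 := finrank_add_le_finrank_inf W ((nullSpace Bᴴ).comap π)
      have h2 := finrank_add_le_finrank_comap π (nullSpace Bᴴ)
      have h3 := rank_add_finrank_nullSpace_conjTranspose B
      rw [finrank_fintype_fun_eq_card] at h1 h2
      rw [finrank_fintype_fun_eq_card] at h2
      omega
    · intro x hx h0
      by_contra hne
      have := key x hx hne
      rw [h0, hform_zero] at this
      exact lt_irrefl _ this

lemma finrank_map_add_finrank_inf_ker {V V' : Type*} [AddCommGroup V] [Module ℂ V]
    [FiniteDimensional ℂ V] [AddCommGroup V'] [Module ℂ V'] (f : V →ₗ[ℂ] V')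
    (W : Submodule ℂ V) :
    finrank ℂ (W.map f) + finrank ℂ ↥(W ⊓ LinearMap.ker f) = finrank ℂ W := by
  have h := LinearMap.finrank_range_add_finrank_ker (f.domRestrict W)
  rw [LinearMap.range_domRestrict, LinearMap.ker_domRestrict] at h
  rw [← h, ← Submodule.map_comap_subtype]
  congr 1
  exact finrank_map_of_forall_eq_zero _ _ fun x _ hx => Subtype.ext hx

/-- Vectors in `W` with vanishing first component are counted by their second components. -/
lemma finrank_inf_ker_funLeft_le {W : Submodule ℂ (ι ⊕ κ → ℂ)} {S : Submodule ℂ (κ → ℂ)}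
    (h : ∀ w, Sum.elim (0 : ι → ℂ) w ∈ W → w ∈ S) :
    finrank ℂ ↥(W ⊓ LinearMap.ker (LinearMap.funLeft ℂ ℂ (Sum.inl : ι → ι ⊕ κ))) ≤
      finrank ℂ S := by
  have key : ∀ x ∈ W ⊓ LinearMap.ker (LinearMap.funLeft ℂ ℂ (Sum.inl : ι → ι ⊕ κ)),
      x = Sum.elim (0 : ι → ℂ) (x ∘ Sum.inr) := by
    rintro x ⟨-, hx⟩
    have : x ∘ Sum.inl = 0 := hx
    rw [← this, Sum.elim_comp_inl_inr]
  rw [← finrank_map_of_forall_eq_zero (LinearMap.funLeft ℂ ℂ (Sum.inr : κ → ι ⊕ κ))]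
  · refine Submodule.finrank_mono ?_
    rintro _ ⟨x, hx, rfl⟩
    exact h _ (key x hx ▸ hx.1)
  · intro x hx h0
    have : x ∘ Sum.inr = 0 := h0
    rw [key x hx, this]
    ext (i | i) <;> rfl

/-- The preimage under `R` of the column space of `B`, with its dimension. -/
lemma exists_preimage_colSpace (R : Matrix ι ι ℂ) (B : Matrix ι κ ℂ) :
    ∃ Y : Submodule ℂ (ι → ℂ), (∀ y ∈ Y, ∃ w, R *ᵥ y = B *ᵥ w) ∧
      Fintype.card ι + B.rank ≤ (fromCols R B).rank + finrank ℂ Y := by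
  refine ⟨(nullSpace (fromCols R B)).map (LinearMap.funLeft ℂ ℂ Sum.inl), ?_, ?_⟩
  · rintro _ ⟨x, hx, rfl⟩
    refine ⟨-(x ∘ Sum.inr), ?_⟩
    have : fromCols R B *ᵥ x = 0 := hx
    rw [fromCols_mulVec] at this
    rw [mulVec_neg]
    exact eq_neg_of_add_eq_zero_left this
  · have h1 := rank_add_finrank_nullSpace (fromCols R B)
    have h2 := rank_add_finrank_nullSpace B
    have h3 := finrank_map_add_finrank_inf_ker (LinearMap.funLeft ℂ ℂ (Sum.inl : ι → ι ⊕ κ))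
      (nullSpace (fromCols R B))
    have h4 := finrank_inf_ker_funLeft_le (W := nullSpace (fromCols R B)) (S := nullSpace B)
      fun w hw => by
        rw [mem_nullSpace, fromCols_mulVec] at hw
        simpa using hw
    rw [Fintype.card_sum] at h1
    omega

/-- A positive subspace of the preimage `Y` of the column space of `B`, given a negative
subspace of the null space of `Bᴴ`. -/
lemma exists_pos_subspace_preimage {R : Matrix ι ι ℂ} (hR : R.IsHermitian) (B : Matrix ι κ ℂ)
    {Y N : Submodule ℂ (ι → ℂ)} (hY : ∀ y ∈ Y, ∃ w, R *ᵥ y = B *ᵥ w) (hN : N ≤ nullSpace Bᴴ)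
    (hneg : ∀ x ∈ N, x ≠ 0 → hform R x < 0) :
    ∃ T ≤ Y, (∀ x ∈ T, x ≠ 0 → 0 < hform R x) ∧
      posInertia R + finrank ℂ Y + finrank ℂ N ≤ finrank ℂ T + Fintype.card ι := by
  obtain ⟨V, hV, δ, hδ, hpos⟩ := exists_pos_subspace hR
  -- Y and N are orthogonal for the form of R, because R maps Y into the range of B and N lies in
  -- ker Bᴴ. The form at y + x is thus the sum of the two forms; when it is positive, the negative
  -- part in N forces the part in Y to be positive.
  let g : (Y × N) →ₗ[ℂ] (ι → ℂ) := Y.subtype.coprod N.subtype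
  let p : (Y × N) →ₗ[ℂ] (ι → ℂ) := Y.subtype ∘ₗ LinearMap.fst ℂ Y N
  have hg : ∀ e, hform R (g e) = hform R e.1 + hform R e.2 := fun e => by
    obtain ⟨w, hw⟩ := hY e.1 e.1.2
    have h0 : Bᴴ *ᵥ (e.2 : ι → ℂ) = 0 := hN e.2.2
    simp only [g, LinearMap.coprod_apply, Submodule.subtype_apply]
    rw [add_comm, hform_add hR, hw, rip_mulVec, h0, rip_zero_left]
    ring
  have key : ∀ e ∈ V.comap g, e ≠ 0 → 0 < hform R (p e) := by
    intro e he hne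
    have h1 := hpos _ he
    have h2 := hg e
    change 0 < hform R e.1
    by_cases hz : e.2 = 0
    · have h3 : e.1 ≠ 0 := fun h => hne (Prod.ext h hz)
      have h4 : g e = e.1 := by simp [g, hz]
      rw [h4] at h1
      have := rip_self_pos (x := (e.1 : ι → ℂ)) (by simpa using h3)
      nlinarith
    · have := hneg _ e.2.2 (by simpa using hz)
      have := rip_self_nonneg (g e)
      nlinarith
  refine ⟨(V.comap g).map p, ?_, ?_, ?_⟩
  · rintro _ ⟨e, -, rfl⟩
    exact e.1.2
  · rintro _ ⟨e, he, rfl⟩ hne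
    exact key e he fun h => hne (by rw [h, map_zero])
  · rw [finrank_map_of_forall_eq_zero]
    · have := finrank_add_le_finrank_comap g V
      rw [finrank_prod, finrank_fintype_fun_eq_card] at this
      omega
    · intro e he h0
      by_contra hne
      have := key e he hne
      rw [h0, hform_zero] at this
      exact lt_irrefl _ this

/-- A positive subspace `T` whose image under `R` lies in the column space of `B` can be removed
from the form by subtracting a positive semidefinite `B H Bᴴ`. -/
lemma exists_posSemidef_sub {R : Matrix ι ι ℂ} (hR : R.IsHermitian) (B : Matrix ι κ ℂ)
    {T : Submodule ℂ (ι → ℂ)} (hT : ∀ y ∈ T, ∃ w, R *ᵥ y = B *ᵥ w)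
    (hpos : ∀ x ∈ T, x ≠ 0 → 0 < hform R x) :
    ∃ H : Matrix κ κ ℂ, H.PosSemidef ∧ (R - B * H * Bᴴ).rank + finrank ℂ T ≤ R.rank ∧
      negInertia (R - B * H * Bᴴ) ≤ negInertia R := by
  let b := Module.finBasis ℂ T
  let Xm : Matrix ι (Fin (finrank ℂ T)) ℂ := Matrix.of fun i j => (b j : ι → ℂ) i
  have hXm : ∀ y, Xm *ᵥ y = (∑ j, y j • b j : T) := fun y => by
    ext i
    simp [Xm, mulVec, dotProduct, mul_comm]
  have hXpos : ∀ y, y ≠ 0 → 0 < hform R (Xm *ᵥ y) := fun y hy => by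
    rw [hXm]
    refine hpos _ (Subtype.property _) fun h => hy ?_
    exact funext (Fintype.linearIndependent_iff.1 b.linearIndependent y (Subtype.ext h))
  obtain ⟨K, hK⟩ := exists_eq_mul (R * Xm) B fun y => by
    rw [← mulVec_mulVec, hXm]; exact hT _ (Subtype.property _)
  -- G is the Gram matrix of R on T, and BHBᴴ = R Xm G⁻¹ Xmᴴ R, so R' is a Schur complement. The
  -- matrix C projects along T onto its R-orthogonal complement, and R' = CᴴRC keeps i₋ from
  -- growing.
  set G := Xmᴴ * R * Xm with hGdef
  have hGh : G.IsHermitian := isHermitian_conjTranspose_mul_mul Xm hR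
  have hGform : ∀ y, hform G y = hform R (Xm *ᵥ y) := fun y => by
    rw [hform, hform, hGdef, ← mulVec_mulVec, ← mulVec_mulVec, rip_mulVec,
      conjTranspose_conjTranspose]
  have hGpd : G.PosDef := (posDef_iff_hform hGh).2 fun y hy => by
    rw [hGform]; exact hXpos y hy
  have hGdet : IsUnit G.det := (isUnit_iff_isUnit_det G).1 hGpd.isUnit
  set H := K * G⁻¹ * Kᴴ with hH
  have hHpsd : H.PosSemidef := hGpd.inv.posSemidef.mul_mul_conjTranspose_same K
  have hR' : R - B * H * Bᴴ = R - R * Xm * G⁻¹ * (Xmᴴ * R) := by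
    have : Xmᴴ * R = Kᴴ * Bᴴ := by
      rw [← conjTranspose_mul, ← hK, conjTranspose_mul, hR.eq]
    rw [this, hK, hH]
    simp only [Matrix.mul_assoc]
  have hR'h := isHermitian_resid hR B hHpsd.1
  set R' := R - B * H * Bᴴ with hR'def
  set C := 1 - Xm * G⁻¹ * (Xmᴴ * R) with hC
  have hR'C : R' = R * C := by
    rw [hR', hC, Matrix.mul_sub, Matrix.mul_one]; simp only [Matrix.mul_assoc]
  have hXC : Xmᴴ * R * C = 0 := by
    rw [hC, Matrix.mul_sub, Matrix.mul_one]
    have : Xmᴴ * R * (Xm * G⁻¹ * (Xmᴴ * R)) = G * G⁻¹ * (Xmᴴ * R) := by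
      rw [hGdef]; simp only [Matrix.mul_assoc]
    rw [this, Matrix.mul_nonsing_inv _ hGdet, Matrix.one_mul, sub_self]
  have hCX : C * Xm = 0 := by
    rw [hC, Matrix.sub_mul, Matrix.one_mul]
    have : Xm * G⁻¹ * (Xmᴴ * R) * Xm = Xm * (G⁻¹ * G) := by
      rw [hGdef]; simp only [Matrix.mul_assoc]
    rw [this, Matrix.nonsing_inv_mul _ hGdet, Matrix.mul_one, sub_self]
  have hCRC : Cᴴ * R * C = R' := by
    have h1 : Cᴴ = 1 - R * (Xm * (G⁻¹ * Xmᴴ)) := by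
      rw [hC, conjTranspose_sub, conjTranspose_one]
      simp only [conjTranspose_mul, conjTranspose_conjTranspose, hR.eq, hGh.inv.eq,
        Matrix.mul_assoc]
    rw [h1, Matrix.sub_mul, Matrix.sub_mul, Matrix.one_mul, ← hR'C]
    have : R * (Xm * (G⁻¹ * Xmᴴ)) * R * C = R * Xm * G⁻¹ * (Xmᴴ * R * C) := by
      simp only [Matrix.mul_assoc]
    rw [this, hXC, Matrix.mul_zero, sub_zero]
  have hneg : negInertia R' ≤ negInertia R := by
    rw [negInertia_eq_posInertia_neg hR'h, negInertia_eq_posInertia_neg hR]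
    have := posInertia_transfer hR'h.neg hR.neg LinearMap.id C.mulVecLin Function.injective_id
      fun x hx => by
        rw [hform_neg] at hx ⊢
        have : hform R' x = hform R (C *ᵥ x) := by
          rw [hform, hform, ← hCRC, ← mulVec_mulVec, ← mulVec_mulVec, rip_mulVec,
            conjTranspose_conjTranspose]
        simpa [this] using hx
    rw [finrank_fintype_fun_eq_card] at this
    omega
  have hXR : ∀ y, R *ᵥ Xm *ᵥ y = 0 → y = 0 := fun y hy => by
    by_contra hne
    have := hXpos y hne
    rw [hform, hy, rip_zero_right] at this
    exact lt_irrefl _ this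
  have hrank : R'.rank + finrank ℂ T ≤ R.rank := by
    have h1 := rank_add_finrank_nullSpace R
    have h2 := rank_add_finrank_nullSpace R'
    have hdis : Disjoint (nullSpace R) (LinearMap.range Xm.mulVecLin) := by
      rw [Submodule.disjoint_def]
      rintro _ hx ⟨y, rfl⟩
      rw [hXR y hx, map_zero]
    have hinj : Function.Injective Xm.mulVecLin := by
      rw [injective_iff_map_eq_zero]
      intro y hy
      exact hXR y (by rw [mulVecLin_apply] at hy; rw [hy, mulVec_zero])
    have h3 := LinearMap.finrank_range_of_inj hinj
    rw [finrank_fintype_fun_eq_card, Fintype.card_fin] at h3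
    have h4 := Submodule.finrank_sup_add_finrank_inf_eq (nullSpace R) (LinearMap.range Xm.mulVecLin)
    rw [hdis.eq_bot, finrank_bot] at h4
    -- The new kernel contains both the old one and T, which are independent since R is positive on
    -- T.
    have h5 : nullSpace R ⊔ LinearMap.range Xm.mulVecLin ≤ nullSpace R' := by
      refine sup_le (fun x hx => ?_) ?_
      · rw [mem_nullSpace] at hx ⊢
        rw [hR', sub_mulVec, ← mulVec_mulVec x (_ * _ * _), ← mulVec_mulVec x Xmᴴ, hx]; simp
      · rintro _ ⟨y, rfl⟩
        rw [mem_nullSpace, hR'C, mulVecLin_apply, mulVec_mulVec, Matrix.mul_assoc, hCX]; simp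
    have h6 := Submodule.finrank_mono h5
    omega
  exact ⟨H, hHpsd, hrank, hneg⟩

/-- Subtracting a positive semidefinite `B H Bᴴ` can reduce the rank as far as the bounds on the
positive inertia allow, without increasing the negative inertia. -/
lemma exists_posSemidef_rank_sub_le {R : Matrix ι ι ℂ} (hR : R.IsHermitian) (B : Matrix ι κ ℂ) :
    ∃ H : Matrix κ κ ℂ, H.PosSemidef ∧ negInertia (R - B * H * Bᴴ) ≤ negInertia R ∧
      (R - B * H * Bᴴ).rank + negInertia (fromBlocks R B Bᴴ 0) ≤
        negInertia R + (fromCols R B).rank := by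
  obtain ⟨N, hN, hneg, hdN⟩ := exists_neg_subspace_nullSpace hR B
  obtain ⟨Y, hY, hdY⟩ := exists_preimage_colSpace R B
  obtain ⟨T, hTY, hpos, hdT⟩ := exists_pos_subspace_preimage hR B hY hN hneg
  obtain ⟨H, hH, hrank, hle⟩ := exists_posSemidef_sub hR B (fun y hy => hY y (hTY hy)) hpos
  refine ⟨H, hH, hle, ?_⟩
  -- The rank drops by at least dim T; in the estimates of dim Y and dim N the terms r(B) cancel.
  have := posInertia_add_negInertia hR
  omega

end Projections

/-! ### Extending the kernel of a compression -/

section Completion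

variable {ι κ : Type*} [Fintype ι] [Fintype κ] [DecidableEq ι] [DecidableEq κ]

/-- The null space of the compression of `R` to the null space of `Dᴴ`. -/
def compressionKer (R : Matrix ι ι ℂ) (D : Matrix ι κ ℂ) : Submodule ℂ (ι → ℂ) :=
  nullSpace Dᴴ ⊓ (LinearMap.range D.mulVecLin).comap R.mulVecLin

/-- A perturbation `B (F L + Lᴴ F) Bᴴ` extending as much as possible of the kernel of the
compression of `R` to a kernel of `R` itself. -/
lemma exists_kernel_completion (R : Matrix ι ι ℂ) (B : Matrix ι κ ℂ)
    {F : Matrix κ κ ℂ} (hF : F.IsHermitian) :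
    ∃ L : Matrix κ κ ℂ,
      finrank ℂ (compressionKer (R - B * (F * L + Lᴴ * F) * Bᴴ) (B * F)) +
        finrank ℂ ↥(nullSpace (R - B * (F * L + Lᴴ * F) * Bᴴ) ⊓ nullSpace Bᴴ) ≤
      finrank ℂ ↥(nullSpace (R - B * (F * L + Lᴴ * F) * Bᴴ) ⊓ nullSpace (B * F)ᴴ) +
        finrank ℂ ↥(nullSpace Bᴴ ⊓
          compressionKer (R - B * (F * L + Lᴴ * F) * Bᴴ) (B * F)) := by
  -- Bᴴ is injective on S, so Bᴴx determines x there. As R maps S into the range of BF, some L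
  -- satisfies Rx = BF L Bᴴx on S. The term LᴴF contributes nothing on ker (BF)ᴴ, hence the
  -- perturbed matrix kills S while its compression is unchanged.
  obtain ⟨S, hSK, hdis, hdim⟩ := exists_disjoint_le (compressionKer R (B * F))
    (nullSpace Bᴴ ⊓ compressionKer R (B * F))
  have hBS : LinearMap.ker (Bᴴ.mulVecLin.domRestrict S) = ⊥ := by
    rw [LinearMap.ker_eq_bot']
    intro x hx
    exact Subtype.ext (Submodule.disjoint_def.1 hdis x x.2 ⟨hx, hSK x.2⟩)
  obtain ⟨ψ, hψ⟩ := LinearMap.exists_leftInverse_of_injective _ hBS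
  have hψ' : ∀ x : S, ψ (Bᴴ *ᵥ (x : ι → ℂ)) = x := fun x => LinearMap.congr_fun hψ x
  have hG : ∀ y, LinearMap.toMatrix' (R.mulVecLin ∘ₗ S.subtype ∘ₗ ψ) *ᵥ y = R *ᵥ (ψ y : ι → ℂ) :=
    fun y => by rw [LinearMap.toMatrix'_mulVec]; rfl
  obtain ⟨L, hL⟩ := exists_eq_mul (LinearMap.toMatrix' (R.mulVecLin ∘ₗ S.subtype ∘ₗ ψ)) (B * F)
    fun y => by
      obtain ⟨w, hw⟩ := (hSK (ψ y).2).2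
      exact ⟨w, by rw [hG]; exact hw.symm⟩
  refine ⟨L, ?_⟩
  set R' := R - B * (F * L + Lᴴ * F) * Bᴴ with hR'
  have hD : (B * F)ᴴ = F * Bᴴ := by rw [conjTranspose_mul, hF.eq]
  have hact : ∀ x ∈ nullSpace (B * F)ᴴ, R' *ᵥ x = R *ᵥ x - (B * F) *ᵥ (L *ᵥ Bᴴ *ᵥ x) := by
    intro x hx
    rw [mem_nullSpace, hD, ← mulVec_mulVec] at hx
    rw [hR', sub_mulVec, ← mulVec_mulVec, Matrix.mul_add, add_mulVec, ← Matrix.mul_assoc,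
      ← Matrix.mul_assoc, ← mulVec_mulVec _ (B * Lᴴ), hx, mulVec_zero, add_zero, ← mulVec_mulVec]
  have hV : nullSpace Bᴴ ≤ nullSpace (B * F)ᴴ := fun x hx => by
    rw [mem_nullSpace] at hx ⊢
    rw [hD, ← mulVec_mulVec, hx, mulVec_zero]
  have hK : compressionKer R' (B * F) = compressionKer R (B * F) := by
    ext x
    refine and_congr_right fun hx => ?_
    have h := hact x hx
    constructor
    · rintro ⟨w, hw⟩
      refine ⟨w + L *ᵥ Bᴴ *ᵥ x, ?_⟩
      change (B * F) *ᵥ w = R' *ᵥ x at hw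
      change (B * F) *ᵥ _ = R *ᵥ x
      rw [mulVec_add, hw, h, sub_add_cancel]
    · rintro ⟨w, hw⟩
      refine ⟨w - L *ᵥ Bᴴ *ᵥ x, ?_⟩
      change (B * F) *ᵥ w = R *ᵥ x at hw
      change (B * F) *ᵥ _ = R' *ᵥ x
      rw [mulVec_sub, hw, h]
  rw [hK]
  have h1 : S ≤ nullSpace R' ⊓ nullSpace (B * F)ᴴ := by
    intro x hx
    refine ⟨?_, (hSK hx).1⟩
    change R' *ᵥ x = 0
    rw [hact x (hSK hx).1, mulVec_mulVec, ← hL, hG]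
    have := hψ' ⟨x, hx⟩
    simp only at this
    rw [this, sub_self]
  have h2 : nullSpace R' ⊓ nullSpace Bᴴ ≤ nullSpace Bᴴ ⊓ compressionKer R (B * F) := by
    rintro x ⟨hx, hx'⟩
    refine ⟨hx', ?_⟩
    rw [← hK]
    exact ⟨hV hx', 0, by rw [map_zero]; exact hx.symm⟩
  have h3 := Submodule.finrank_sup_add_finrank_inf_eq S (nullSpace R' ⊓ nullSpace Bᴴ)
  rw [(hdis.mono_right h2).eq_bot, finrank_bot] at h3
  have h4 := Submodule.finrank_mono (sup_le h1 (inf_le_inf_left (nullSpace R') hV))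
  omega

lemma rank_resid_le (A : Matrix ι ι ℂ) (B : Matrix ι κ ℂ) (X : Matrix κ κ ℂ) :
    (A - B * X * Bᴴ).rank ≤ (fromCols A B).rank := by
  have : A - B * X * Bᴴ = fromCols A B * fromRows (1 : Matrix ι ι ℂ) (-(X * Bᴴ)) := by
    rw [fromCols_mul_fromRows, Matrix.mul_one, Matrix.mul_neg, ← Matrix.mul_assoc, sub_eq_add_neg]
  rw [this]
  exact rank_mul_le_left _ _

/-- On ker Bᴴ the term BXBᴴ vanishes. With `rank_fromCols_add`, this makes r[A, B] insensitive to X.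
-/
lemma nullSpace_inf_congr {A : Matrix ι ι ℂ} (hA : A.IsHermitian) (B : Matrix ι κ ℂ)
    {X : Matrix κ κ ℂ} :
    nullSpace (A - B * X * Bᴴ) ⊓ nullSpace Bᴴ = nullSpace Aᴴ ⊓ nullSpace Bᴴ := by
  ext x
  refine and_congr_left fun hx => ?_
  change Bᴴ *ᵥ x = 0 at hx
  change _ *ᵥ x = 0 ↔ _ *ᵥ x = 0
  rw [sub_mulVec, ← mulVec_mulVec, hx, mulVec_zero, sub_zero, hA.eq]

/-- If the column spaces of `P` and `B` are disjoint, then `r(P) + r(B) ≤ r[P, B]`. -/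
lemma rank_add_rank_le {P : Matrix ι ι ℂ} {B : Matrix ι κ ℂ}
    (h : ∀ y z, P *ᵥ y = B *ᵥ z → P *ᵥ y = 0) :
    P.rank + B.rank ≤ (fromCols P B).rank := by
  have h1 := rank_add_finrank_nullSpace (fromCols P B)
  have h2 := rank_add_finrank_nullSpace P
  have h3 := rank_add_finrank_nullSpace B
  have h4 := finrank_map_add_finrank_inf_ker (LinearMap.funLeft ℂ ℂ (Sum.inl : ι → ι ⊕ κ))
    (nullSpace (fromCols P B))
  have h5 := finrank_inf_ker_funLeft_le (W := nullSpace (fromCols P B)) (S := nullSpace B)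
    fun w hw => by
      rw [mem_nullSpace, fromCols_mulVec] at hw
      simpa using hw
  have h6 : (nullSpace (fromCols P B)).map (LinearMap.funLeft ℂ ℂ (Sum.inl : ι → ι ⊕ κ)) ≤
      nullSpace P := by
    rintro _ ⟨x, hx, rfl⟩
    have hx' : fromCols P B *ᵥ x = 0 := hx
    rw [fromCols_mulVec] at hx'
    refine h (x ∘ Sum.inl) (-(x ∘ Sum.inr)) ?_
    rw [mulVec_neg]
    exact eq_neg_of_add_eq_zero_left hx'
  have h7 := Submodule.finrank_mono h6
  rw [Fintype.card_sum] at h1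
  omega

end Completion

/-! ### Bounds for every solution of the constraint -/

section Pair

variable {m₁ m₂ n : ℕ} {A₁ : Matrix (Fin m₁) (Fin m₁) ℂ} {A₂ : Matrix (Fin m₂) (Fin m₂) ℂ}
  (B₁ : Matrix (Fin m₁) (Fin n) ℂ) (B₂ : Matrix (Fin m₂) (Fin n) ℂ)

lemma matM_eq_bordered (A₁ : Matrix (Fin m₁) (Fin m₁) ℂ) (A₂ : Matrix (Fin m₂) (Fin m₂) ℂ) :
    matM A₁ A₂ B₁ B₂ = fromBlocks (fromBlocks A₁ 0 0 (-A₂)) (fromRows B₁ B₂)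
      (fromRows B₁ B₂)ᴴ 0 := by
  rw [matM, conjTranspose_fromRows_eq_fromCols_conjTranspose]

lemma isHermitian_matM (hA₁ : A₁.IsHermitian) (hA₂ : A₂.IsHermitian) :
    (matM A₁ A₂ B₁ B₂).IsHermitian := by
  rw [matM_eq_bordered]
  exact isHermitian_bordered (IsHermitian.fromBlocks hA₁ (by simp) hA₂.neg) _

/-- The form of `M` in coordinates shifted by a Hermitian matrix `X`. -/
lemma hform_matM_shift {X : Matrix (Fin n) (Fin n) ℂ} (hX : X.IsHermitian)
    (u : Fin m₁ → ℂ) (v : Fin m₂ → ℂ) (w : Fin n → ℂ) :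
    hform (matM A₁ A₂ B₁ B₂) (Sum.elim (Sum.elim u v)
        (w + ((1 / 2 : ℝ) : ℂ) • X *ᵥ (B₂ᴴ *ᵥ v - B₁ᴴ *ᵥ u))) =
      hform (A₁ - B₁ * X * B₁ᴴ) u + hform (B₂ * X * B₂ᴴ - A₂) v +
        2 * rip (B₁ᴴ *ᵥ u + B₂ᴴ *ᵥ v) w := by
  have h1 : hform (fromBlocks A₁ 0 0 (-A₂)) (Sum.elim u v) = hform A₁ u - hform A₂ v := by
    rw [hform, fromBlocks_mulVec, rip_elim]
    simp [hform, neg_mulVec, sub_eq_add_neg]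
  have h2 : (fromRows B₁ B₂)ᴴ *ᵥ (Sum.elim u v) = B₁ᴴ *ᵥ u + B₂ᴴ *ᵥ v := by
    rw [conjTranspose_fromRows_eq_fromCols_conjTranspose, fromCols_mulVec]
    simp
  have h3 := hform_congr_sub A₂ B₂ X v
  have h4 : hform (B₂ * X * B₂ᴴ - A₂) v = -hform (A₂ - B₂ * X * B₂ᴴ) v := by
    rw [← hform_neg, neg_sub]
  -- Since X is Hermitian, the mixed terms in u and v produced by the shift cancel, leaving only the
  -- two residual forms.
  have h5 : rip (B₂ᴴ *ᵥ v) (X *ᵥ B₁ᴴ *ᵥ u) = rip (B₁ᴴ *ᵥ u) (X *ᵥ B₂ᴴ *ᵥ v) := by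
    rw [rip_mulVec, hX.eq, rip_comm]
  rw [matM_eq_bordered, hform_bordered, h1, h2, h4, h3, hform_congr_sub, rip_add_right,
    rip_smul_right, mulVec_sub, rip_add_left, rip_add_left]
  simp only [rip_sub_right, h5]
  ring

/-- The embedding underlying `hform_matM_shift`. -/
def shiftL (X : Matrix (Fin n) (Fin n) ℂ) {E : Type*} [AddCommGroup E] [Module ℂ E]
    (u : E →ₗ[ℂ] (Fin m₁ → ℂ)) (v : E →ₗ[ℂ] (Fin m₂ → ℂ)) (w : E →ₗ[ℂ] (Fin n → ℂ)) :
    E →ₗ[ℂ] ((Fin m₁ ⊕ Fin m₂) ⊕ Fin n → ℂ) :=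
  elimL (elimL u v) (w + ((1 / 2 : ℝ) : ℂ) • X.mulVecLin ∘ₗ
    (B₂ᴴ.mulVecLin ∘ₗ v - B₁ᴴ.mulVecLin ∘ₗ u))

lemma hform_matM_shiftL {X : Matrix (Fin n) (Fin n) ℂ} (hX : X.IsHermitian)
    {E : Type*} [AddCommGroup E] [Module ℂ E]
    (u : E →ₗ[ℂ] (Fin m₁ → ℂ)) (v : E →ₗ[ℂ] (Fin m₂ → ℂ)) (w : E →ₗ[ℂ] (Fin n → ℂ)) (e : E) :
    hform (matM A₁ A₂ B₁ B₂) (shiftL B₁ B₂ X u v w e) =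
      hform (A₁ - B₁ * X * B₁ᴴ) (u e) + hform (B₂ * X * B₂ᴴ - A₂) (v e) +
        2 * rip (B₁ᴴ *ᵥ u e + B₂ᴴ *ᵥ v e) (w e) :=
  hform_matM_shift B₁ B₂ hX _ _ _

lemma shiftL_injective (X : Matrix (Fin n) (Fin n) ℂ) {E : Type*} [AddCommGroup E] [Module ℂ E]
    {u : E →ₗ[ℂ] (Fin m₁ → ℂ)} {v : E →ₗ[ℂ] (Fin m₂ → ℂ)} {w : E →ₗ[ℂ] (Fin n → ℂ)}
    (h : ∀ e, u e = 0 → v e = 0 → w e = 0 → e = 0) :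
    Function.Injective (shiftL B₁ B₂ X u v w) := by
  rw [injective_iff_map_eq_zero]
  intro e he
  have hu : u e = 0 := funext fun i => congrFun he (Sum.inl (Sum.inl i))
  have hv : v e = 0 := funext fun i => congrFun he (Sum.inl (Sum.inr i))
  have hw : w e + ((1 / 2 : ℝ) : ℂ) • X *ᵥ (B₂ᴴ *ᵥ v e - B₁ᴴ *ᵥ u e) = 0 :=
    funext fun i => congrFun he (Sum.inr i)
  refine h e hu hv ?_
  simpa [hu, hv] using hw

/-- `i₊(A₁ - B₁ X B₁ᴴ) + r[A₂, B₂] ≤ i₊(M)` for every solution `X`. -/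
lemma posInertia_resid_add_le (hA₁ : A₁.IsHermitian) (hA₂ : A₂.IsHermitian)
    {X : Matrix (Fin n) (Fin n) ℂ} (hX : X ∈ lmiSol A₂ B₂) :
    posInertia (resid A₁ B₁ X) + rowRank A₂ B₂ ≤ posInertia (matM A₁ A₂ B₁ B₂) := by
  obtain ⟨hXh, hP⟩ := hX
  have hR := isHermitian_resid hA₁ B₁ hXh
  obtain ⟨V, hV, δ, hδ, hpos⟩ := exists_pos_subspace hR
  obtain ⟨C, hC, hCle⟩ := exists_hform_le (isHermitian_mul_conjTranspose_self B₁)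
  obtain ⟨S, -, hdis, hS⟩ := exists_disjoint_le ⊤ (nullSpace A₂ᴴ ⊓ nullSpace B₂ᴴ)
  have h1 := rank_fromCols_add A₂ B₂
  rw [finrank_top, finrank_fintype_fun_eq_card] at hS
  -- Put w = εb with b = B₂ᴴv and c = B₁ᴴu. From |b + c|² ≥ 0 the cross term is at least ε|b|² -
  -- ε|c|², and |c|² ≤ C|u|². This ε makes the loss at most δ|u|²/2, half of what V provides. If u
  -- and b vanish, P(v) > 0 because S avoids the common kernel of A₂ and B₂ᴴ.
  have hε : 0 < δ / (2 * C) := by positivity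
  have h2 := finrank_le_posInertia_of_map (isHermitian_matM B₁ B₂ hA₁ hA₂)
    (shiftL B₁ B₂ X (V.subtype ∘ₗ LinearMap.fst ℂ V S) (S.subtype ∘ₗ LinearMap.snd ℂ V S)
      (((δ / (2 * C) : ℝ) : ℂ) • B₂ᴴ.mulVecLin ∘ₗ S.subtype ∘ₗ LinearMap.snd ℂ V S))
    (fun e hne => by
      rw [hform_matM_shiftL B₁ B₂ hXh]
      obtain ⟨⟨u, hu⟩, ⟨v, hv⟩⟩ := e
      simp only [LinearMap.comp_apply, LinearMap.fst_apply, LinearMap.snd_apply,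
        Submodule.subtype_apply, LinearMap.smul_apply, mulVecLin_apply, rip_smul_right,
        rip_add_left]
      set c := B₁ᴴ *ᵥ u with hc
      set b := B₂ᴴ *ᵥ v with hb
      set ε := δ / (2 * C) with hεd
      have e1 : rip c c ≤ C * rip u u := by
        have := hCle u
        rwa [hform, ← mulVec_mulVec, rip_mulVec] at this
      have e2 : 0 ≤ rip b b + rip c c + 2 * rip c b := by
        have := rip_self_nonneg (b + c)
        simp only [rip_add_left, rip_add_right, rip_comm b c] at this
        linarith
      have e3 := hpos u hu
      have e4 := (posSemidef_iff_hform hP.1).1 hP v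
      have e5 : ε * (C * rip u u) = δ / 2 * rip u u := by rw [hεd]; field_simp
      have e6 := mul_le_mul_of_nonneg_left e1 hε.le
      have e7 := mul_nonneg hε.le e2
      have e8 := mul_nonneg hε.le (rip_self_nonneg b)
      have e9 := rip_self_nonneg u
      have e3' : δ * rip u u ≤ hform (A₁ - B₁ * X * B₁ᴴ) u := e3
      have hmain : δ / 2 * rip u u + ε * rip b b + hform (B₂ * X * B₂ᴴ - A₂) v ≤
          hform (A₁ - B₁ * X * B₁ᴴ) u + hform (B₂ * X * B₂ᴴ - A₂) v +
            2 * (ε * (rip c b + rip b b)) := by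
        rw [e5] at e6
        linarith
      refine lt_of_lt_of_le ?_ hmain
      by_cases hu0 : u = 0
      · have hv0 : v ≠ 0 := fun h => hne (by simp [hu0, h])
        by_cases hb0 : b = 0
        · have hPv : hform (B₂ * X * B₂ᴴ - A₂) v ≠ 0 := by
            intro h0
            have h0' : star v ⬝ᵥ (B₂ * X * B₂ᴴ - A₂) *ᵥ v = 0 :=
              Complex.ext h0 (im_dotProduct_mulVec hP.1 v)
            rw [hP.dotProduct_mulVec_zero_iff] at h0'
            rw [sub_mulVec, ← mulVec_mulVec, ← hb, hb0, mulVec_zero, zero_sub, neg_eq_zero] at h0'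
            exact hv0 (Submodule.disjoint_def.1 hdis v hv ⟨by rw [hA₂.eq]; exact h0', hb0⟩)
          have := lt_of_le_of_ne e4 hPv.symm
          rw [hu0, hb0]
          simpa using this
        · have := mul_pos hε (rip_self_pos hb0)
          have := mul_nonneg hδ.le e9
          linarith
      · have := mul_pos hδ (rip_self_pos hu0)
        linarith)
  rw [finrank_prod, hV] at h2
  have h3 : rowRank A₂ B₂ = (fromCols A₂ B₂).rank := rfl
  have h4 : posInertia (resid A₁ B₁ X) = posInertia (A₁ - B₁ * X * B₁ᴴ) := rfl
  omega

lemma elim_mem_nullSpace_matN (hA₁ : A₁.IsHermitian) {z : Fin m₁ → ℂ} {w : Fin n → ℂ} :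
    Sum.elim z w ∈ nullSpace (matN A₁ B₁ B₂)ᴴ ↔
      A₁ *ᵥ z + B₁ *ᵥ w = 0 ∧ B₁ᴴ *ᵥ z = 0 ∧ B₂ *ᵥ w = 0 := by
  rw [mem_nullSpace, matN, conjTranspose_fromCols_eq_fromRows_conjTranspose, fromRows_mulVec,
    fromBlocks_conjTranspose, fromBlocks_mulVec, conjTranspose_fromRows_eq_fromCols_conjTranspose,
    fromCols_mulVec]
  simp only [Sum.elim_comp_inl, Sum.elim_comp_inr, conjTranspose_zero, conjTranspose_conjTranspose,
    zero_mulVec, zero_add, add_zero, hA₁.eq]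
  constructor
  · intro h
    exact ⟨funext fun i => congrFun h (Sum.inl (Sum.inl i)),
      funext fun i => congrFun h (Sum.inl (Sum.inr i)), funext fun i => congrFun h (Sum.inr i)⟩
  · rintro ⟨h1, h2, h3⟩
    rw [h1, h2, h3]
    ext ((i | i) | i) <;> rfl

/-- `i₋(M) + r[A₁, B₁] ≤ i₋(A₁ - B₁ X B₁ᴴ) + r(N)` for every solution `X`. -/
lemma negInertia_matM_add_le (hA₁ : A₁.IsHermitian) (hA₂ : A₂.IsHermitian)
    {X : Matrix (Fin n) (Fin n) ℂ} (hX : X ∈ lmiSol A₂ B₂) :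
    negInertia (matM A₁ A₂ B₁ B₂) + rowRank A₁ B₁ ≤
      negInertia (resid A₁ B₁ X) + (matN A₁ B₁ B₂).rank := by
  obtain ⟨hXh, hP⟩ := hX
  have hR := isHermitian_resid hA₁ B₁ hXh
  have hM := isHermitian_matM B₁ B₂ hA₁ hA₂
  set R := A₁ - B₁ * X * B₁ᴴ with hRdef
  set Z := nullSpace (matN A₁ B₁ B₂)ᴴ with hZ
  let π : (Fin m₁ ⊕ Fin n → ℂ) →ₗ[ℂ] (Fin n → ℂ) := LinearMap.funLeft ℂ ℂ Sum.inr
  let Q := LinearMap.range (π.domRestrict Z)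
  -- The section picks, for each w in Q, some ζw with A₁ζw + B₁w = 0, B₁ᴴζw = 0 and B₂w = 0. Then ζw
  -- is isotropic for R and R(u - ζw) = R(u) + 2 Re⟨B₁ᴴu, w⟩, which is the form of M without P(v) ≥
  -- 0. Negative vectors of M thus map to negative vectors of R.
  obtain ⟨s, hs⟩ := (π.domRestrict Z).rangeRestrict.exists_rightInverse_of_surjective
    (LinearMap.range_rangeRestrict _)
  let ζ : Q →ₗ[ℂ] (Fin m₁ → ℂ) := LinearMap.funLeft ℂ ℂ Sum.inl ∘ₗ Z.subtype ∘ₗ s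
  have hsw : ∀ w : Q, A₁ *ᵥ ζ w + B₁ *ᵥ (w : Fin n → ℂ) = 0 ∧ B₁ᴴ *ᵥ ζ w = 0 ∧
      B₂ *ᵥ (w : Fin n → ℂ) = 0 := fun w => by
    rw [← elim_mem_nullSpace_matN B₁ B₂ hA₁]
    have h1 : (s w : Fin m₁ ⊕ Fin n → ℂ) ∘ Sum.inr = w :=
      congrArg Subtype.val (LinearMap.congr_fun hs w)
    have h2 : Sum.elim (ζ w) (w : Fin n → ℂ) = s w := by
      rw [← h1]; exact Sum.elim_comp_inl_inr _
    rw [h2]; exact (s w).2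
  let pu := LinearMap.fst ℂ (Fin m₁ → ℂ) ((Fin m₂ → ℂ) × Q)
  let pv := LinearMap.fst ℂ (Fin m₂ → ℂ) Q ∘ₗ LinearMap.snd ℂ (Fin m₁ → ℂ) ((Fin m₂ → ℂ) × Q)
  let pw := LinearMap.snd ℂ (Fin m₂ → ℂ) Q ∘ₗ LinearMap.snd ℂ (Fin m₁ → ℂ) ((Fin m₂ → ℂ) × Q)
  have h1 := posInertia_transfer hM.neg hR.neg (shiftL B₁ B₂ X pu pv (Q.subtype ∘ₗ pw))
    (pu - ζ ∘ₗ pw)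
    (shiftL_injective B₁ B₂ X fun e h1 h2 h3 => Prod.ext h1 (Prod.ext h2 (Subtype.ext h3)))
    (fun e he => by
      rw [hform_neg, hform_matM_shiftL B₁ B₂ hXh] at he
      rw [hform_neg]
      obtain ⟨u, v, w⟩ := e
      change 0 < -(hform R u + hform (B₂ * X * B₂ᴴ - A₂) v +
        2 * rip (B₁ᴴ *ᵥ u + B₂ᴴ *ᵥ v) (w : Fin n → ℂ)) at he
      change 0 < -hform R (u - ζ w)
      obtain ⟨e1, e2, e3⟩ := hsw w
      have e4 := (posSemidef_iff_hform hP.1).1 hP v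
      have e5 : rip (B₂ᴴ *ᵥ v) (w : Fin n → ℂ) = 0 := by
        rw [← rip_mulVec, e3, rip_zero_right]
      have e6 : R *ᵥ ζ w = -(B₁ *ᵥ (w : Fin n → ℂ)) := by
        rw [hRdef, sub_mulVec, ← mulVec_mulVec, e2, mulVec_zero, sub_zero]
        exact eq_neg_of_add_eq_zero_left e1
      have e7 : hform R (-ζ w) = 0 := by
        simp only [hform, mulVec_neg, e6, rip_neg_left, neg_neg]
        rw [rip_mulVec, e2, rip_zero_left, neg_zero]
      have e8 : hform R (u - ζ w) = hform R u + 2 * rip (B₁ᴴ *ᵥ u) (w : Fin n → ℂ) := by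
        rw [sub_eq_add_neg, hform_add hR, e7, mulVec_neg, e6, neg_neg, rip_mulVec]
        ring
      rw [rip_add_left, e5] at he
      rw [e8]
      linarith)
  -- It remains to bound dim Q below: the part of ker Nᴴ with w = 0 embeds in the common kernel of
  -- A₁ and B₁ᴴ.
  have h2 := LinearMap.finrank_range_add_finrank_ker (π.domRestrict Z)
  have h3 := rank_add_finrank_nullSpace_conjTranspose (matN A₁ B₁ B₂)
  have h4 := rank_fromCols_add A₁ B₁
  have h5 : finrank ℂ (LinearMap.ker (π.domRestrict Z)) ≤
      finrank ℂ ↥(nullSpace A₁ᴴ ⊓ nullSpace B₁ᴴ) := by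
    have key : ∀ x : LinearMap.ker (π.domRestrict Z),
        Sum.elim ((x : Fin m₁ ⊕ Fin n → ℂ) ∘ Sum.inl) 0 = (x : Fin m₁ ⊕ Fin n → ℂ) := fun x => by
      have : (x : Fin m₁ ⊕ Fin n → ℂ) ∘ Sum.inr = 0 := x.2
      rw [← this, Sum.elim_comp_inl_inr]
    refine LinearMap.finrank_le_finrank_of_injective
      (f := (LinearMap.funLeft ℂ ℂ (Sum.inl : Fin m₁ → Fin m₁ ⊕ Fin n) ∘ₗ Z.subtype ∘ₗ
        Submodule.subtype _).codRestrict _ fun x => ?_) ?_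
    · have hx : (x : Fin m₁ ⊕ Fin n → ℂ) ∈ Z := x.1.2
      rw [← key x] at hx
      replace hx := (elim_mem_nullSpace_matN B₁ B₂ hA₁).1 hx
      refine ⟨?_, hx.2.1⟩
      have := hx.1
      rw [mulVec_zero, add_zero] at this
      rw [hA₁.eq]
      exact this
    · rw [injective_iff_map_eq_zero]
      intro x hx
      have h0 : (x : Fin m₁ ⊕ Fin n → ℂ) ∘ Sum.inl = 0 := congrArg Subtype.val hx
      apply Subtype.ext; apply Subtype.ext
      rw [← key x, h0]
      ext (i | i) <;> rfl
  rw [← negInertia_eq_posInertia_neg hM, ← negInertia_eq_posInertia_neg hR, finrank_prod,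
    finrank_prod] at h1
  simp only [finrank_fintype_fun_eq_card, Fintype.card_sum, Fintype.card_fin] at h1 h3 h4
  have h6 : rowRank A₁ B₁ = (fromCols A₁ B₁).rank := rfl
  have h7 : negInertia (resid A₁ B₁ X) = negInertia R := rfl
  change finrank ℂ Q + _ = finrank ℂ (nullSpace (matN A₁ B₁ B₂)ᴴ) at h2
  omega

end Pair

/-! ### Construction of the extremal solutions -/

section Pair

variable {m₁ m₂ n : ℕ} {A₁ : Matrix (Fin m₁) (Fin m₁) ℂ} {A₂ : Matrix (Fin m₂) (Fin m₂) ℂ}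
  (B₁ : Matrix (Fin m₁) (Fin n) ℂ) (B₂ : Matrix (Fin m₂) (Fin n) ℂ)

/-- Upper bound for `i₊(M)` in terms of the bordered matrix with border `B₁ F`, where `F` fixes
the null space of `B₂`. -/
lemma posInertia_matM_le (hA₁ : A₁.IsHermitian) (hA₂ : A₂.IsHermitian)
    {X F : Matrix (Fin n) (Fin n) ℂ} (hX : X.IsHermitian) (hF : ∀ w ∈ nullSpace B₂, F *ᵥ w = w) :
    posInertia (matM A₁ A₂ B₁ B₂) ≤ (B₂ * X * B₂ᴴ - A₂).rank + B₂.rank +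
      posInertia (fromBlocks (A₁ - B₁ * X * B₁ᴴ) (B₁ * F) (B₁ * F)ᴴ 0) := by
  have hR := isHermitian_resid hA₁ B₁ hX
  set P := B₂ * X * B₂ᴴ - A₂ with hP
  -- Restricting v to ker P and w to ker B₂ costs r(P) + r(B₂) dimensions. It removes every term
  -- with v, and Fw = w replaces B₁ by B₁F.
  let E := (Fin m₁ → ℂ) × nullSpace P × nullSpace B₂
  let pu : E →ₗ[ℂ] (Fin m₁ → ℂ) := LinearMap.fst ℂ _ _
  let pv : E →ₗ[ℂ] nullSpace P := LinearMap.fst ℂ _ _ ∘ₗ LinearMap.snd ℂ _ _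
  let pw : E →ₗ[ℂ] nullSpace B₂ := LinearMap.snd ℂ _ _ ∘ₗ LinearMap.snd ℂ _ _
  have h1 := posInertia_transfer (isHermitian_matM B₁ B₂ hA₁ hA₂) (isHermitian_bordered hR (B₁ * F))
    (shiftL B₁ B₂ X pu ((nullSpace P).subtype ∘ₗ pv) ((nullSpace B₂).subtype ∘ₗ pw))
    (elimL pu ((nullSpace B₂).subtype ∘ₗ pw))
    (shiftL_injective B₁ B₂ X fun e h1 h2 h3 =>
      Prod.ext h1 (Prod.ext (Subtype.ext h2) (Subtype.ext h3)))
    (fun e he => by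
      rw [hform_matM_shiftL B₁ B₂ hX] at he
      obtain ⟨u, ⟨v, hv⟩, ⟨w, hw⟩⟩ := e
      change 0 < hform (A₁ - B₁ * X * B₁ᴴ) u + hform P v +
        2 * rip (B₁ᴴ *ᵥ u + B₂ᴴ *ᵥ v) w at he
      rw [elimL_apply, hform_bordered]
      change 0 < hform (A₁ - B₁ * X * B₁ᴴ) u + 2 * rip ((B₁ * F)ᴴ *ᵥ u) w
      rw [mem_nullSpace] at hv
      have e1 : hform P v = 0 := by rw [hform, hv, rip_zero_right]
      have e2 : rip (B₂ᴴ *ᵥ v) w = 0 := by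
        rw [← rip_mulVec, mem_nullSpace.1 hw, rip_zero_right]
      rw [e1, rip_add_left, e2] at he
      rw [← rip_mulVec, ← mulVec_mulVec, hF w hw, rip_mulVec]
      linarith)
  have h2 := rank_add_finrank_nullSpace P
  have h3 := rank_add_finrank_nullSpace B₂
  rw [finrank_prod, finrank_prod] at h1
  simp only [finrank_fintype_fun_eq_card, Fintype.card_sum, Fintype.card_fin] at h1 h2 h3
  omega

/-- Disjoint ranges make ranks add, and [P, B₂] has the same rank as [A₂, B₂] because P acts as -A₂
on ker B₂ᴴ. -/
lemma rank_add_rank_le_rowRank (hA₂ : A₂.IsHermitian) {X : Matrix (Fin n) (Fin n) ℂ}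
    (hX : X.IsHermitian)
    (hdis : ∀ y z, (B₂ * X * B₂ᴴ - A₂) *ᵥ y = B₂ *ᵥ z → (B₂ * X * B₂ᴴ - A₂) *ᵥ y = 0) :
    (B₂ * X * B₂ᴴ - A₂).rank + B₂.rank ≤ rowRank A₂ B₂ := by
  have h1 := rank_add_rank_le hdis
  have h2 := rank_fromCols_add (B₂ * X * B₂ᴴ - A₂) B₂
  have h3 := rank_fromCols_add A₂ B₂
  have h4 : nullSpace (B₂ * X * B₂ᴴ - A₂)ᴴ ⊓ nullSpace B₂ᴴ = nullSpace A₂ᴴ ⊓ nullSpace B₂ᴴ := by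
    ext x
    refine and_congr_left fun hx => ?_
    change B₂ᴴ *ᵥ x = 0 at hx
    change _ *ᵥ x = 0 ↔ _ *ᵥ x = 0
    rw [((isHermitian_mul_mul_conjTranspose B₂ hX).sub hA₂).eq, sub_mulVec, ← mulVec_mulVec, hx,
      mulVec_zero, zero_sub, neg_eq_zero, hA₂.eq]
  rw [h4] at h2
  have h5 : rowRank A₂ B₂ = (fromCols A₂ B₂).rank := rfl
  omega

/-- The kernel of `M` projects to the kernel of a compression of `A₁ - B₁ X B₁ᴴ`. -/
lemma rank_matM_ge (hA₂ : A₂.IsHermitian) {X F : Matrix (Fin n) (Fin n) ℂ} (hFh : F.IsHermitian) (hBF : B₂ * F = 0)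
    (hF : ∀ w ∈ nullSpace B₂, F *ᵥ w = w)
    (hdis : ∀ y z, (B₂ * X * B₂ᴴ - A₂) *ᵥ y = B₂ *ᵥ z → (B₂ * X * B₂ᴴ - A₂) *ᵥ y = 0) :
    m₁ + n + rowRank A₂ B₂ ≤ (matM A₁ A₂ B₁ B₂).rank +
      finrank ℂ (compressionKer (A₁ - B₁ * X * B₁ᴴ) (B₁ * F)) +
      finrank ℂ ↥(nullSpace B₂ ⊓ nullSpace B₁) := by
  have h1 := rank_add_finrank_nullSpace (matM A₁ A₂ B₁ B₂)
  have h2 := rank_fromCols_add A₂ B₂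
  have hFB : F * B₂ᴴ = 0 := by
    have := congrArg conjTranspose hBF
    rwa [conjTranspose_mul, hFh.eq, conjTranspose_zero] at this
  have hmem : ∀ x ∈ nullSpace (matM A₁ A₂ B₁ B₂), ∀ u v w,
      u = x ∘ Sum.inl ∘ Sum.inl → v = x ∘ Sum.inl ∘ Sum.inr → w = x ∘ Sum.inr →
      A₁ *ᵥ u + B₁ *ᵥ w = 0 ∧ -(A₂ *ᵥ v) + B₂ *ᵥ w = 0 ∧ B₁ᴴ *ᵥ u + B₂ᴴ *ᵥ v = 0 := by
    rintro x hx u v w rfl rfl rfl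
    rw [mem_nullSpace, matM, fromBlocks_mulVec, fromBlocks_mulVec, fromCols_mulVec,
      fromRows_mulVec] at hx
    simp only [zero_mulVec, zero_add, add_zero, neg_mulVec] at hx
    exact ⟨funext fun i => congrFun hx (Sum.inl (Sum.inl i)),
      funext fun i => congrFun hx (Sum.inl (Sum.inr i)), funext fun i => congrFun hx (Sum.inr i)⟩
  let π₁ : ((Fin m₁ ⊕ Fin m₂) ⊕ Fin n → ℂ) →ₗ[ℂ] (Fin m₁ → ℂ) :=
    LinearMap.funLeft ℂ ℂ (Sum.inl ∘ Sum.inl)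
  let π₂ : ((Fin m₁ ⊕ Fin m₂) ⊕ Fin n → ℂ) →ₗ[ℂ] (Fin m₂ → ℂ) :=
    LinearMap.funLeft ℂ ℂ (Sum.inl ∘ Sum.inr)
  let π₃ : ((Fin m₁ ⊕ Fin m₂) ⊕ Fin n → ℂ) →ₗ[ℂ] (Fin n → ℂ) :=
    LinearMap.funLeft ℂ ℂ Sum.inr
  -- The kernel of M is filtered by its u, v and w coordinates; each layer is bounded separately.
  have h3 := finrank_map_add_finrank_inf_ker π₁ (nullSpace (matM A₁ A₂ B₁ B₂))
  have h4 := finrank_map_add_finrank_inf_ker π₂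
    (nullSpace (matM A₁ A₂ B₁ B₂) ⊓ LinearMap.ker π₁)
  have h5 := finrank_map_of_forall_eq_zero π₃
    (nullSpace (matM A₁ A₂ B₁ B₂) ⊓ LinearMap.ker π₁ ⊓ LinearMap.ker π₂) (by
      rintro x ⟨⟨-, hu⟩, hv⟩ hw
      ext ((i | i) | i)
      · exact congrFun hu i
      · exact congrFun hv i
      · exact congrFun hw i)
  have h6 : (nullSpace (matM A₁ A₂ B₁ B₂)).map π₁ ≤
      compressionKer (A₁ - B₁ * X * B₁ᴴ) (B₁ * F) := by
    rintro _ ⟨x, hx, rfl⟩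
    obtain ⟨e1, e2, e3⟩ := hmem x hx (π₁ x) (π₂ x) (π₃ x) rfl rfl rfl
    set u := π₁ x
    set v := π₂ x
    set w := π₃ x
    have e4 : B₁ᴴ *ᵥ u = -(B₂ᴴ *ᵥ v) := eq_neg_of_add_eq_zero_left e3
    -- Pv lies in the range of B₂, so it vanishes by disjointness. Hence XB₂ᴴv - w is in ker B₂, is
    -- fixed by F, and witnesses that R maps u into the range of B₁F.
    have e5 : (B₂ * X * B₂ᴴ - A₂) *ᵥ v = B₂ *ᵥ (X *ᵥ B₂ᴴ *ᵥ v - w) := by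
      rw [sub_mulVec, ← mulVec_mulVec, ← mulVec_mulVec, mulVec_sub]
      have : B₂ *ᵥ w = A₂ *ᵥ v := by
        rw [eq_neg_of_add_eq_zero_right e2, neg_neg]
      rw [this]
    have e6 : (X *ᵥ B₂ᴴ *ᵥ v - w) ∈ nullSpace B₂ := by
      rw [mem_nullSpace, ← e5]; exact hdis _ _ e5
    refine ⟨?_, X *ᵥ B₂ᴴ *ᵥ v - w, ?_⟩
    · rw [SetLike.mem_coe, mem_nullSpace, conjTranspose_mul, hFh.eq, ← mulVec_mulVec, e4,
        mulVec_neg, mulVec_mulVec, hFB, zero_mulVec, neg_zero]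
    · change (B₁ * F) *ᵥ _ = (A₁ - B₁ * X * B₁ᴴ) *ᵥ u
      rw [← mulVec_mulVec, hF _ e6, sub_mulVec, ← mulVec_mulVec, ← mulVec_mulVec, e4, mulVec_sub,
        eq_neg_of_add_eq_zero_left e1, mulVec_neg, mulVec_neg]
      abel
  have h7 : (nullSpace (matM A₁ A₂ B₁ B₂) ⊓ LinearMap.ker π₁).map π₂ ≤
      nullSpace A₂ᴴ ⊓ nullSpace B₂ᴴ := by
    rintro _ ⟨x, ⟨hx, hu⟩, rfl⟩
    obtain ⟨e1, e2, e3⟩ := hmem x hx (π₁ x) (π₂ x) (π₃ x) rfl rfl rfl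
    have hu' : π₁ x = 0 := hu
    rw [hu', mulVec_zero, zero_add] at e3
    have e5 : (B₂ * X * B₂ᴴ - A₂) *ᵥ π₂ x = B₂ *ᵥ (-π₃ x) := by
      rw [sub_mulVec, ← mulVec_mulVec, e3, mulVec_zero, zero_sub, mulVec_neg]
      rw [eq_neg_of_add_eq_zero_right e2, neg_neg]
    have e6 := hdis _ _ e5
    rw [sub_mulVec, ← mulVec_mulVec, e3, mulVec_zero, zero_sub, neg_eq_zero] at e6
    exact ⟨by rw [hA₂.eq]; exact e6, e3⟩
  have h8 : (nullSpace (matM A₁ A₂ B₁ B₂) ⊓ LinearMap.ker π₁ ⊓ LinearMap.ker π₂).map π₃ ≤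
      nullSpace B₂ ⊓ nullSpace B₁ := by
    rintro _ ⟨x, ⟨⟨hx, hu⟩, hv⟩, rfl⟩
    obtain ⟨e1, e2, e3⟩ := hmem x hx (π₁ x) (π₂ x) (π₃ x) rfl rfl rfl
    have hu' : π₁ x = 0 := hu
    have hv' : π₂ x = 0 := hv
    rw [hu', mulVec_zero, zero_add] at e1
    rw [hv', mulVec_zero, neg_zero, zero_add] at e2
    exact ⟨e2, e1⟩
  have h9 := Submodule.finrank_mono h6
  have h10 := Submodule.finrank_mono h7
  have h11 := Submodule.finrank_mono h8
  have h12 : rowRank A₂ B₂ = (fromCols A₂ B₂).rank := rfl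
  simp only [Fintype.card_sum, Fintype.card_fin] at h1 h2
  omega

/-- A lower bound for ker Nᴴ: if R sends z in ker B₁ᴴ to B₁Fy, then (z, -Fy) is in it, and so is (0,
w) for w in the common kernel of B₁ and B₂. -/
lemma rank_matN_le (hA₁ : A₁.IsHermitian) {X F : Matrix (Fin n) (Fin n) ℂ}
    (hBF : B₂ * F = 0) :
    (matN A₁ B₁ B₂).rank +
      finrank ℂ ↥(nullSpace B₁ᴴ ⊓ compressionKer (A₁ - B₁ * X * B₁ᴴ) (B₁ * F)) +
      finrank ℂ ↥(nullSpace B₂ ⊓ nullSpace B₁) ≤ m₁ + n := by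
  have h1 := rank_add_finrank_nullSpace_conjTranspose (matN A₁ B₁ B₂)
  let π : (Fin m₁ ⊕ Fin n → ℂ) →ₗ[ℂ] (Fin m₁ → ℂ) := LinearMap.funLeft ℂ ℂ Sum.inl
  have h2 := finrank_map_add_finrank_inf_ker π (nullSpace (matN A₁ B₁ B₂)ᴴ)
  have h3 : nullSpace B₁ᴴ ⊓ compressionKer (A₁ - B₁ * X * B₁ᴴ) (B₁ * F) ≤
      (nullSpace (matN A₁ B₁ B₂)ᴴ).map π := by
    rintro z ⟨hz, -, y, hy⟩
    refine ⟨Sum.elim z (-(F *ᵥ y)), ?_, rfl⟩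
    change B₁ᴴ *ᵥ z = 0 at hz
    change (B₁ * F) *ᵥ y = (A₁ - B₁ * X * B₁ᴴ) *ᵥ z at hy
    rw [sub_mulVec, ← mulVec_mulVec z, hz, mulVec_zero, sub_zero] at hy
    refine (elim_mem_nullSpace_matN B₁ B₂ hA₁).2 ⟨?_, hz, ?_⟩
    · rw [← hy, mulVec_neg, mulVec_mulVec, add_neg_cancel]
    · rw [mulVec_neg, mulVec_mulVec, hBF, zero_mulVec, neg_zero]
  let j : (Fin n → ℂ) →ₗ[ℂ] (Fin m₁ ⊕ Fin n → ℂ) := elimL 0 LinearMap.id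
  have h4 : (nullSpace B₂ ⊓ nullSpace B₁).map j ≤
      nullSpace (matN A₁ B₁ B₂)ᴴ ⊓ LinearMap.ker π := by
    rintro _ ⟨w, ⟨hw2, hw1⟩, rfl⟩
    refine ⟨(elim_mem_nullSpace_matN B₁ B₂ hA₁).2 ⟨?_, ?_, hw2⟩, rfl⟩
    · simpa using hw1
    · simp
  have h5 := finrank_map_of_forall_eq_zero j (nullSpace B₂ ⊓ nullSpace B₁)
    fun w _ hw => funext fun i => congrFun hw (Sum.inr i)
  have h6 := Submodule.finrank_mono h3
  have h7 := Submodule.finrank_mono h4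
  simp only [Fintype.card_sum, Fintype.card_fin] at h1
  omega

/-- A solution attaining the largest `i₊` and the smallest `i₋` simultaneously. -/
lemma exists_max_pos_min_neg (hA₁ : A₁.IsHermitian) (hA₂ : A₂.IsHermitian)
    (hne : (lmiSol A₂ B₂).Nonempty) :
    ∃ X ∈ lmiSol A₂ B₂,
      posInertia (matM A₁ A₂ B₁ B₂) ≤ posInertia (resid A₁ B₁ X) + rowRank A₂ B₂ ∧
      negInertia (resid A₁ B₁ X) + (matN A₁ B₁ B₂).rank ≤
        negInertia (matM A₁ A₂ B₁ B₂) + rowRank A₁ B₁ := by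
  obtain ⟨X, hX, hP⟩ := hne
  obtain ⟨X₀, hX₀, hP₀, hdis₀⟩ := exists_minimal_solution B₂ hX hP
  obtain ⟨F, hFh, hFF, hFS, hF⟩ := exists_orthogonal_projector (nullSpace B₂)
  have hBF : B₂ * F = 0 := Matrix.toLin'.injective (LinearMap.ext fun x => by
    rw [toLin'_apply, ← mulVec_mulVec, mem_nullSpace.1 (hFS x), map_zero, LinearMap.zero_apply])
  have hFB : F * B₂ᴴ = 0 := by
    have := congrArg conjTranspose hBF
    rwa [conjTranspose_mul, hFh.eq, conjTranspose_zero] at this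
  obtain ⟨L, hL⟩ := exists_kernel_completion (A₁ - B₁ * X₀ * B₁ᴴ) B₁ hFh
  have hY : (F * L + Lᴴ * F).IsHermitian := by
    rw [IsHermitian, conjTranspose_add, conjTranspose_mul, conjTranspose_mul, hFh.eq,
      conjTranspose_conjTranspose, add_comm]
  set X₁ := X₀ + (F * L + Lᴴ * F) with hX₁
  have hX₁h : X₁.IsHermitian := hX₀.add hY
  have hBX₁ : B₂ * X₁ * B₂ᴴ = B₂ * X₀ * B₂ᴴ := by
    have : B₂ * (F * L + Lᴴ * F) * B₂ᴴ = 0 := by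
      rw [Matrix.mul_add, Matrix.add_mul, ← Matrix.mul_assoc, hBF, Matrix.zero_mul,
        Matrix.zero_mul, Matrix.mul_assoc, Matrix.mul_assoc, hFB, Matrix.mul_zero, Matrix.mul_zero,
        add_zero]
    rw [hX₁, Matrix.mul_add, Matrix.add_mul, this, add_zero]
  have hRX₁ : A₁ - B₁ * X₀ * B₁ᴴ - B₁ * (F * L + Lᴴ * F) * B₁ᴴ = A₁ - B₁ * X₁ * B₁ᴴ := by
    rw [hX₁, Matrix.mul_add B₁ X₀, Matrix.add_mul (B₁ * X₀), sub_sub]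
  rw [hRX₁] at hL
  clear_value X₁
  have hdis : ∀ y z, (B₂ * X₁ * B₂ᴴ - A₂) *ᵥ y = B₂ *ᵥ z → (B₂ * X₁ * B₂ᴴ - A₂) *ᵥ y = 0 := by
    rw [hBX₁]; exact hdis₀
  have hR := isHermitian_resid hA₁ B₁ hX₁h
  -- Since FF = F, the perturbation along B₁F is the passage from X₁ to X₁ - tF, which the
  -- constraint does not see.
  obtain ⟨t, ht, hpos⟩ := exists_posInertia_bordered_le hR (B₁ * F)
  have hres : A₁ - B₁ * X₁ * B₁ᴴ - B₁ * F * (((-t : ℝ) : ℂ) • (1 : Matrix (Fin n) (Fin n) ℂ)) * (B₁ * F)ᴴ =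
      resid A₁ B₁ (X₁ + ((-t : ℝ) : ℂ) • F) := by
    rw [resid, conjTranspose_mul, hFh.eq, Matrix.mul_add, Matrix.add_mul, sub_sub]
    simp only [Matrix.mul_smul, Matrix.smul_mul, Matrix.mul_one]
    rw [← Matrix.mul_assoc, Matrix.mul_assoc B₁ F F, hFF]
  have hB : B₂ * (X₁ + ((-t : ℝ) : ℂ) • F) * B₂ᴴ = B₂ * X₀ * B₂ᴴ := by
    rw [Matrix.mul_add, Matrix.add_mul, hBX₁, Matrix.mul_smul, hBF, smul_zero, Matrix.zero_mul,
      add_zero]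
  have hsmul : (((-t : ℝ) : ℂ) • F).IsHermitian := by
    rw [IsHermitian, conjTranspose_smul, hFh.eq]; simp
  refine ⟨X₁ + ((-t : ℝ) : ℂ) • F, ⟨hX₁h.add hsmul, by rw [hB]; exact hP₀⟩, ?_, ?_⟩
  all_goals
    have h1 := posInertia_matM_le B₁ B₂ hA₁ hA₂ hX₁h hF
    have h2 := rank_add_rank_le_rowRank B₂ hA₂ hX₁h hdis
    rw [hres] at hpos
  · omega
  -- i₋ is bounded as rank minus i₊. The rank is at most r[R, B₁F], which the choice of L makes
  -- small; the kernel counts for M and N convert this into i₋(M) and r(N).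
  · have hrank := rank_resid_le (A₁ - B₁ * X₁ * B₁ᴴ) (B₁ * F) (((-t : ℝ) : ℂ) • (1 : Matrix (Fin n) (Fin n) ℂ))
    rw [hres] at hrank
    have h3 := posInertia_add_negInertia (isHermitian_resid hA₁ B₁ (hX₁h.add hsmul))
    have h4 := rank_matM_ge B₁ B₂ (A₁ := A₁) hA₂ hFh hBF hF hdis
    have h5 := rank_matN_le B₁ B₂ hA₁ (X := X₁) hBF
    have h6 := rank_fromCols_add (A₁ - B₁ * X₁ * B₁ᴴ) (B₁ * F)
    have h7 := rank_fromCols_add A₁ B₁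
    rw [← nullSpace_inf_congr hA₁ B₁ (X := X₁)] at h7
    rw [hR.eq] at h6
    have h8 := posInertia_add_negInertia (isHermitian_matM B₁ B₂ hA₁ hA₂)
    have h9 : rowRank A₁ B₁ = (fromCols A₁ B₁).rank := rfl
    rw [Fintype.card_fin] at h6 h7
    change posInertia (resid A₁ B₁ _) + negInertia (resid A₁ B₁ _) = (resid A₁ B₁ _).rank at h3
    omega

/-- Adding a positive semidefinite matrix preserves solutions of `B X Bᴴ ≽ A`. -/
lemma add_mem_lmiSol {X H : Matrix (Fin n) (Fin n) ℂ} (hX : X ∈ lmiSol A₂ B₂)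
    (hH : H.PosSemidef) : X + H ∈ lmiSol A₂ B₂ := by
  refine ⟨hX.1.add hH.1, ?_⟩
  have : B₂ * (X + H) * B₂ᴴ - A₂ = (B₂ * X * B₂ᴴ - A₂) + B₂ * H * B₂ᴴ := by
    rw [Matrix.mul_add, Matrix.add_mul]; abel
  rw [this]
  exact hX.2.add (hH.mul_mul_conjTranspose_same B₂)

lemma isHermitian_resid_of_mem (hA₁ : A₁.IsHermitian) {X : Matrix (Fin n) (Fin n) ℂ}
    (hX : X ∈ lmiSol A₂ B₂) : (resid A₁ B₁ X).IsHermitian :=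
  isHermitian_resid hA₁ B₁ hX.1

lemma resid_add (A₁ : Matrix (Fin m₁) (Fin m₁) ℂ) (X H : Matrix (Fin n) (Fin n) ℂ) :
    resid A₁ B₁ (X + H) = resid A₁ B₁ X - B₁ * H * B₁ᴴ := by
  rw [resid, resid, Matrix.mul_add, Matrix.add_mul, sub_sub]

/-- Shifting the last coordinate by ½XB₁ᴴu carries one bordered form to the other. The two inertias
agree, but only this direction is needed. -/
lemma negInertia_bordered_resid (hA₁ : A₁.IsHermitian) {X : Matrix (Fin n) (Fin n) ℂ}
    (hX : X.IsHermitian) :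
    negInertia (bordered A₁ B₁) ≤ negInertia (bordered (resid A₁ B₁ X) B₁) := by
  have hR := isHermitian_resid hA₁ B₁ hX
  have h1 := isHermitian_bordered hA₁ B₁
  have h2 := isHermitian_bordered hR B₁
  have h3 := posInertia_transfer h1.neg h2.neg LinearMap.id
    (elimL (LinearMap.funLeft ℂ ℂ Sum.inl) (LinearMap.funLeft ℂ ℂ Sum.inr +
      ((1 / 2 : ℝ) : ℂ) • X.mulVecLin ∘ₗ B₁ᴴ.mulVecLin ∘ₗ LinearMap.funLeft ℂ ℂ Sum.inl))
    Function.injective_id fun e he => by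
      obtain ⟨u, w, rfl⟩ : ∃ u w, e = Sum.elim u w := ⟨_, _, (Sum.elim_comp_inl_inr e).symm⟩
      rw [LinearMap.id_apply, hform_neg, hform_bordered] at he
      rw [hform_neg, elimL_apply]
      change 0 < -hform (fromBlocks (A₁ - B₁ * X * B₁ᴴ) B₁ B₁ᴴ 0)
        (Sum.elim u (w + ((1 / 2 : ℝ) : ℂ) • X *ᵥ B₁ᴴ *ᵥ u))
      rw [hform_bordered, hform_congr_sub, rip_add_right, rip_smul_right]
      linarith
  rw [← negInertia_eq_posInertia_neg h1, ← negInertia_eq_posInertia_neg h2,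
    finrank_fintype_fun_eq_card] at h3
  change negInertia (fromBlocks A₁ B₁ B₁ᴴ 0) ≤
    negInertia (fromBlocks (A₁ - B₁ * X * B₁ᴴ) B₁ B₁ᴴ 0)
  omega

lemma rowRank_resid (hA₁ : A₁.IsHermitian) {X : Matrix (Fin n) (Fin n) ℂ}
    (hX : X.IsHermitian) : rowRank (resid A₁ B₁ X) B₁ = rowRank A₁ B₁ := by
  have h1 := rank_fromCols_add A₁ B₁
  have h2 := rank_fromCols_add (A₁ - B₁ * X * B₁ᴴ) B₁
  rw [(isHermitian_resid hA₁ B₁ hX).eq, nullSpace_inf_congr hA₁ B₁] at h2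
  change (fromCols (A₁ - B₁ * X * B₁ᴴ) B₁).rank = (fromCols A₁ B₁).rank
  omega

/-- A solution attaining the largest `i₋`. -/
lemma exists_max_neg (hA₁ : A₁.IsHermitian) (hne : (lmiSol A₂ B₂).Nonempty) :
    ∃ X ∈ lmiSol A₂ B₂, negInertia (bordered A₁ B₁) ≤ negInertia (resid A₁ B₁ X) := by
  obtain ⟨X, hX⟩ := hne
  have hR := isHermitian_resid_of_mem B₁ B₂ hA₁ hX
  obtain ⟨t, ht, hpos⟩ := exists_posInertia_bordered_le hR.neg B₁
  have hH : ((t : ℂ) • (1 : Matrix (Fin n) (Fin n) ℂ)).PosSemidef :=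
    PosSemidef.one.smul (Complex.zero_le_real.2 ht)
  have hXt := add_mem_lmiSol B₂ hX hH
  refine ⟨X + (t : ℂ) • 1, hXt, ?_⟩
  have h1 := negInertia_bordered_resid B₁ hA₁ hX.1
  -- Replacing w by -w turns the negated bordered form of R into the bordered form of -R.
  have h2 : negInertia (bordered (resid A₁ B₁ X) B₁) ≤
      posInertia (fromBlocks (-resid A₁ B₁ X) B₁ B₁ᴴ 0) := by
    have hb := isHermitian_bordered hR B₁
    rw [bordered, negInertia_eq_posInertia_neg hb]
    have := posInertia_transfer hb.neg (isHermitian_bordered hR.neg B₁) LinearMap.id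
      (elimL (LinearMap.funLeft ℂ ℂ Sum.inl) (-LinearMap.funLeft ℂ ℂ Sum.inr))
      Function.injective_id fun e he => by
        obtain ⟨u, w, rfl⟩ : ∃ u w, e = Sum.elim u w := ⟨_, _, (Sum.elim_comp_inl_inr e).symm⟩
        rw [LinearMap.id_apply, hform_neg, hform_bordered] at he
        rw [elimL_apply]
        change 0 < hform (fromBlocks (-resid A₁ B₁ X) B₁ B₁ᴴ 0) (Sum.elim u (-w))
        rw [hform_bordered, hform_neg, rip_neg_right]
        linarith
    rw [finrank_fintype_fun_eq_card] at this
    omega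
  have h3 : -resid A₁ B₁ X - B₁ * (((-t : ℝ) : ℂ) • (1 : Matrix (Fin n) (Fin n) ℂ)) * B₁ᴴ = -resid A₁ B₁ (X + (t : ℂ) • 1) := by
    rw [resid_add]
    simp [sub_eq_add_neg, add_comm]
  rw [h3, ← negInertia_eq_posInertia_neg (isHermitian_resid_of_mem B₁ B₂ hA₁ hXt)] at hpos
  omega

/-- A solution attaining the smallest rank. -/
lemma exists_min_rank (hA₁ : A₁.IsHermitian) (hA₂ : A₂.IsHermitian)
    (hne : (lmiSol A₂ B₂).Nonempty) :
    ∃ X ∈ lmiSol A₂ B₂,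
      (resid A₁ B₁ X).rank + negInertia (bordered A₁ B₁) + (matN A₁ B₁ B₂).rank ≤
        negInertia (matM A₁ A₂ B₁ B₂) + 2 * rowRank A₁ B₁ := by
  obtain ⟨X, hX, -, hneg⟩ := exists_max_pos_min_neg B₁ B₂ hA₁ hA₂ hne
  obtain ⟨H, hH, -, hrank⟩ :=
    exists_posSemidef_rank_sub_le (isHermitian_resid_of_mem B₁ B₂ hA₁ hX) B₁
  refine ⟨X + H, add_mem_lmiSol B₂ hX hH, ?_⟩
  rw [resid_add]
  have h1 := negInertia_bordered_resid B₁ hA₁ hX.1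
  have h2 := rowRank_resid B₁ hA₁ hX.1
  change _ + negInertia (bordered (resid A₁ B₁ X) B₁) ≤ _ + rowRank (resid A₁ B₁ X) B₁ at hrank
  omega

end Pair

/-! ### Definiteness, invertibility and vanishing read from rank and inertia -/

section Definiteness

variable {ι : Type*} [Fintype ι] [DecidableEq ι]

lemma posInertia_eq_zero_iff {A : Matrix ι ι ℂ} (hA : A.IsHermitian) :
    posInertia A = 0 ↔ (-A).PosSemidef := by
  rw [posSemidef_iff_hform hA.neg]
  constructor
  · intro h x
    obtain ⟨W, hW, hle⟩ := exists_nonpos_subspace hA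
    have hT : W = ⊤ := Submodule.eq_top_of_finrank_eq (by
      rw [finrank_fintype_fun_eq_card]; omega)
    rw [hform_neg, neg_nonneg]
    exact (hle x (hT ▸ Submodule.mem_top)).1
  · intro h
    obtain ⟨W, hW, δ, hδ, hpos⟩ := exists_pos_subspace hA
    rw [← hW, Submodule.finrank_eq_zero, Submodule.eq_bot_iff]
    intro x hx
    by_contra hne
    have h1 := h x
    have h2 := hpos x hx
    rw [hform_neg] at h1
    nlinarith [rip_self_pos hne]

lemma negInertia_eq_zero_iff {A : Matrix ι ι ℂ} (hA : A.IsHermitian) :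
    negInertia A = 0 ↔ A.PosSemidef := by
  rw [negInertia_eq_posInertia_neg hA, posInertia_eq_zero_iff hA.neg, neg_neg]

lemma posInertia_eq_card_iff {A : Matrix ι ι ℂ} (hA : A.IsHermitian) :
    posInertia A = Fintype.card ι ↔ A.PosDef := by
  rw [posDef_iff_hform hA]
  constructor
  · intro h x hne
    obtain ⟨W, hW, δ, hδ, hpos⟩ := exists_pos_subspace hA
    have hT : W = ⊤ := Submodule.eq_top_of_finrank_eq (by
      rw [finrank_fintype_fun_eq_card, hW, h])
    have := hpos x (hT ▸ Submodule.mem_top)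
    nlinarith [rip_self_pos hne]
  · intro h
    have h1 := finrank_le_posInertia hA (W := ⊤) fun x _ hx => h x hx
    rw [finrank_top, finrank_fintype_fun_eq_card] at h1
    have h2 := posInertia_add_negInertia hA
    have h3 := A.rank_le_card_width
    omega

lemma negInertia_eq_card_iff {A : Matrix ι ι ℂ} (hA : A.IsHermitian) :
    negInertia A = Fintype.card ι ↔ (-A).PosDef := by
  rw [negInertia_eq_posInertia_neg hA, posInertia_eq_card_iff hA.neg]

lemma rank_eq_card_iff_isUnit {A : Matrix ι ι ℂ} : A.rank = Fintype.card ι ↔ IsUnit A := by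
  refine ⟨fun h => ?_, fun h => rank_of_isUnit A h⟩
  have h1 := rank_add_finrank_nullSpace A
  have h2 : nullSpace A = ⊥ := Submodule.finrank_eq_zero.1 (by omega)
  rw [← mulVec_injective_iff_isUnit]
  exact LinearMap.ker_eq_bot.1 h2

lemma matrix_rank_eq_zero_iff {κ : Type*} [Fintype κ] [DecidableEq κ] {A : Matrix ι κ ℂ} :
    A.rank = 0 ↔ A = 0 := by
  refine ⟨fun h => ?_, fun h => by rw [h, rank_zero]⟩
  have h1 := rank_add_finrank_nullSpace A
  have h2 : nullSpace A = ⊤ := Submodule.eq_top_of_finrank_eq (by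
    rw [finrank_fintype_fun_eq_card]; omega)
  refine Matrix.toLin'.injective (LinearMap.ext fun x => ?_)
  have h3 : x ∈ nullSpace A := h2 ▸ Submodule.mem_top
  rw [toLin'_apply, mem_nullSpace.1 h3, map_zero, LinearMap.zero_apply]

end Definiteness

/-! ### Solvability and the consistent case -/

section Pair

variable {m₁ m₂ n : ℕ} {A₁ : Matrix (Fin m₁) (Fin m₁) ℂ} {A₂ : Matrix (Fin m₂) (Fin m₂) ℂ}
  (B₁ : Matrix (Fin m₁) (Fin n) ℂ) (B₂ : Matrix (Fin m₂) (Fin n) ℂ)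

lemma exists_max_neg_unconstrained (hA₁ : A₁.IsHermitian) :
    ∃ X : Matrix (Fin n) (Fin n) ℂ, X.IsHermitian ∧
      negInertia (bordered A₁ B₁) ≤ negInertia (resid A₁ B₁ X) := by
  -- A constraint of size m₂ = 0 is vacuous.
  obtain ⟨X, hX, h⟩ := exists_max_neg (A₂ := (0 : Matrix (Fin 0) (Fin 0) ℂ)) B₁ 0 hA₁
    ⟨0, isHermitian_zero, by simpa using PosSemidef.zero⟩
  exact ⟨X, hX.1, h⟩

lemma posSemidef_resid_iff (hA₁ : A₁.IsHermitian) {X : Matrix (Fin n) (Fin n) ℂ}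
    (hX : X.IsHermitian) : (B₁ * X * B₁ᴴ - A₁).PosSemidef ↔ posInertia (resid A₁ B₁ X) = 0 := by
  rw [resid, posInertia_eq_zero_iff (isHermitian_resid hA₁ B₁ hX), neg_sub]

/-- A solution is an X whose residual has i₊ = 0. Over all Hermitian X the least i₊ is r[A,B] minus
i₋ of the bordered matrix, attained where i₋ of the residual is largest. -/
lemma lmiSol_nonempty_iff (hA₁ : A₁.IsHermitian) :
    (lmiSol A₁ B₁).Nonempty ↔ negInertia (bordered A₁ B₁) = rowRank A₁ B₁ := by
  have key : ∀ X : Matrix (Fin n) (Fin n) ℂ, X.IsHermitian →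
      rowRank A₁ B₁ ≤ posInertia (resid A₁ B₁ X) + negInertia (bordered A₁ B₁) ∧
      posInertia (resid A₁ B₁ X) + negInertia (resid A₁ B₁ X) ≤ rowRank A₁ B₁ := fun X hX =>
    ⟨rank_fromCols_le hA₁ B₁ hX, by
      have h1 := posInertia_add_negInertia (isHermitian_resid hA₁ B₁ hX)
      have h2 := rank_resid_le A₁ B₁ X
      exact h1.le.trans h2⟩
  obtain ⟨Y, hY, hle⟩ := exists_max_neg_unconstrained B₁ hA₁
  have hY' := key Y hY
  constructor
  · rintro ⟨X, hX, hP⟩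
    rw [posSemidef_resid_iff B₁ hA₁ hX] at hP
    have := key X hX
    omega
  · intro h
    exact ⟨Y, hY, (posSemidef_resid_iff B₁ hA₁ hY).2 (by omega)⟩

lemma exists_resid_eq_zero_iff (hA₁ : A₁.IsHermitian) :
    (∃ X : Matrix (Fin n) (Fin n) ℂ, X.IsHermitian ∧ B₁ * X * B₁ᴴ = A₁) ↔
      colSpace A₁ ≤ colSpace B₁ := by
  constructor
  · rintro ⟨X, -, hX⟩ _ ⟨y, rfl⟩
    refine ⟨X *ᵥ B₁ᴴ *ᵥ y, ?_⟩
    rw [mulVecLin_apply, mulVecLin_apply, ← hX, ← mulVec_mulVec, ← mulVec_mulVec]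
  · intro h
    obtain ⟨E, hE, -, hES, hEid⟩ := exists_orthogonal_projector (colSpace B₁)
    -- G acts as a generalized inverse: B₁G is the projector onto the range of B₁, so GA₁Gᴴ solves
    -- the equation.
    obtain ⟨G, hG⟩ := exists_eq_mul E B₁ fun x => by
      obtain ⟨w, hw⟩ := hES x
      exact ⟨w, hw.symm⟩
    have hEA : E * A₁ = A₁ := Matrix.toLin'.injective (LinearMap.ext fun x => by
      rw [toLin'_apply, toLin'_apply, ← mulVec_mulVec]
      exact hEid _ (h ⟨x, rfl⟩))
    have hAE : A₁ * E = A₁ := by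
      have := congrArg conjTranspose hEA
      rwa [conjTranspose_mul, hA₁.eq, hE.eq] at this
    refine ⟨G * A₁ * Gᴴ, isHermitian_mul_mul_conjTranspose G hA₁, ?_⟩
    have : B₁ * (G * A₁ * Gᴴ) * B₁ᴴ = (B₁ * G) * A₁ * (B₁ * G)ᴴ := by
      rw [conjTranspose_mul]; simp only [Matrix.mul_assoc]
    rw [this, ← hG, hE.eq, hEA, hAE]

lemma rowRank_eq_rank {X : Matrix (Fin n) (Fin n) ℂ} (h : B₁ * X * B₁ᴴ = A₁) :
    rowRank A₁ B₁ = B₁.rank := by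
  apply le_antisymm
  · have : fromCols A₁ B₁ = B₁ * fromCols (X * B₁ᴴ) (1 : Matrix (Fin n) (Fin n) ℂ) := by
      rw [mul_fromCols, Matrix.mul_one, ← Matrix.mul_assoc, h]
    rw [rowRank, this]
    exact rank_mul_le_left _ _
  · have : B₁ = fromCols A₁ B₁ * fromRows (0 : Matrix (Fin m₁) (Fin n) ℂ)
        (1 : Matrix (Fin n) (Fin n) ℂ) := by
      rw [fromCols_mul_fromRows, Matrix.mul_zero, Matrix.mul_one, zero_add]
    calc B₁.rank = _ := congrArg rank this
      _ ≤ _ := rank_mul_le_left _ _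

/-- When A₁ = B₁XB₁ᴴ, the kernel of B₁ᴴ lies in that of A₁. So ker Nᴴ projects onto ker B₁ᴴ, and its
fibre over 0 is the common kernel of B₁ and B₂. -/
lemma rank_matN_eq (hA₁ : A₁.IsHermitian) {X : Matrix (Fin n) (Fin n) ℂ}
    (h : B₁ * X * B₁ᴴ = A₁) : (matN A₁ B₁ B₂).rank = B₁.rank + colRank B₁ B₂ := by
  have h1 := rank_add_finrank_nullSpace_conjTranspose (matN A₁ B₁ B₂)
  let π : (Fin m₁ ⊕ Fin n → ℂ) →ₗ[ℂ] (Fin m₁ → ℂ) := LinearMap.funLeft ℂ ℂ Sum.inl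
  have h2 := finrank_map_add_finrank_inf_ker π (nullSpace (matN A₁ B₁ B₂)ᴴ)
  have hA : ∀ z, B₁ᴴ *ᵥ z = 0 → A₁ *ᵥ z = 0 := fun z hz => by
    rw [← h, ← mulVec_mulVec, hz, mulVec_zero]
  have h3 : (nullSpace (matN A₁ B₁ B₂)ᴴ).map π = nullSpace B₁ᴴ := by
    ext z
    constructor
    · rintro ⟨x, hx, rfl⟩
      rw [← Sum.elim_comp_inl_inr x] at hx
      exact ((elim_mem_nullSpace_matN B₁ B₂ hA₁).1 hx).2.1
    · intro hz
      refine ⟨Sum.elim z 0, (elim_mem_nullSpace_matN B₁ B₂ hA₁).2 ⟨?_, hz, ?_⟩, rfl⟩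
      · rw [hA z hz, mulVec_zero, add_zero]
      · rw [mulVec_zero]
  have h4 := finrank_inf_ker_funLeft_le (W := nullSpace (matN A₁ B₁ B₂)ᴴ)
    (S := nullSpace (fromRows B₁ B₂)) fun w hw => by
      obtain ⟨e1, -, e2⟩ := (elim_mem_nullSpace_matN B₁ B₂ hA₁).1 hw
      rw [mulVec_zero, zero_add] at e1
      rw [mem_nullSpace, fromRows_mulVec, e1, e2]
      ext (i | i) <;> rfl
  let j : (Fin n → ℂ) →ₗ[ℂ] (Fin m₁ ⊕ Fin n → ℂ) := elimL 0 LinearMap.id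
  have h5 : (nullSpace (fromRows B₁ B₂)).map j ≤
      nullSpace (matN A₁ B₁ B₂)ᴴ ⊓ LinearMap.ker π := by
    rintro _ ⟨w, hw, rfl⟩
    rw [SetLike.mem_coe, mem_nullSpace, fromRows_mulVec] at hw
    refine ⟨(elim_mem_nullSpace_matN B₁ B₂ hA₁).2 ⟨?_, ?_, ?_⟩, rfl⟩
    · have e1 : B₁ *ᵥ w = 0 := funext fun i => congrFun hw (Sum.inl i)
      simpa using e1
    · simp
    · exact funext fun i => congrFun hw (Sum.inr i)
  have h6 := finrank_map_of_forall_eq_zero j (nullSpace (fromRows B₁ B₂))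
    fun w _ hw => funext fun i => congrFun hw (Sum.inr i)
  have h7 := Submodule.finrank_mono h5
  have h8 := rank_add_finrank_nullSpace_conjTranspose B₁
  have h9 := rank_add_finrank_nullSpace (fromRows B₁ B₂)
  have h10 : colRank B₁ B₂ = (fromRows B₁ B₂).rank := rfl
  rw [h3] at h2
  simp only [Fintype.card_sum, Fintype.card_fin] at h1 h8 h9
  change _ + finrank ℂ ↥(nullSpace (matN A₁ B₁ B₂)ᴴ ⊓ LinearMap.ker π) = _ at h2
  change finrank ℂ ↥(nullSpace (matN A₁ B₁ B₂)ᴴ ⊓ LinearMap.ker π) ≤ _ at h4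
  omega

end Pair

end HermLMI

end

/-! ### The theorem, assembled from bounds and extremal solutions -/

open HermLMI in
theorem theorem3p3 (m₁ m₂ n : ℕ)
    (A₁ : Matrix (Fin m₁) (Fin m₁) ℂ) (A₂ : Matrix (Fin m₂) (Fin m₂) ℂ)
    (B₁ : Matrix (Fin m₁) (Fin n) ℂ) (B₂ : Matrix (Fin m₂) (Fin n) ℂ)
    (hA₁ : A₁.IsHermitian) (hA₂ : A₂.IsHermitian) :
    -- solvability criterion for `B₂ X B₂ᴴ ≽ A₂`
    ((lmiSol A₂ B₂).Nonempty ↔ negInertia (bordered A₂ B₂) = rowRank A₂ B₂) ∧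
    ((lmiSol A₂ B₂).Nonempty →
      -- the extremal ranks and inertias
      IsMaxVal (lmiSol A₂ B₂) (fun X => (resid A₁ B₁ X).rank) (rowRank A₁ B₁) ∧
      IsMinVal (lmiSol A₂ B₂) (fun X => (resid A₁ B₁ X).rank)
        (2 * (rowRank A₁ B₁ : ℤ) + negInertia (matM A₁ A₂ B₁ B₂)
          - negInertia (bordered A₁ B₁) - (matN A₁ B₁ B₂).rank) ∧
      IsMaxVal (lmiSol A₂ B₂) (fun X => posInertia (resid A₁ B₁ X))
        ((posInertia (matM A₁ A₂ B₁ B₂) : ℤ) - rowRank A₂ B₂) ∧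
      IsMinVal (lmiSol A₂ B₂) (fun X => posInertia (resid A₁ B₁ X))
        ((rowRank A₁ B₁ : ℤ) - negInertia (bordered A₁ B₁)) ∧
      IsMaxVal (lmiSol A₂ B₂) (fun X => negInertia (resid A₁ B₁ X))
        (negInertia (bordered A₁ B₁)) ∧
      IsMinVal (lmiSol A₂ B₂) (fun X => negInertia (resid A₁ B₁ X))
        ((rowRank A₁ B₁ : ℤ) - (matN A₁ B₁ B₂).rank + negInertia (matM A₁ A₂ B₁ B₂)) ∧
      -- (a)
      ((∃ X : Matrix (Fin n) (Fin n) ℂ, X.IsHermitian ∧ IsUnit (A₁ - B₁ * X * B₁ᴴ) ∧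
          (B₂ * X * B₂ᴴ - A₂).PosSemidef) ↔
        rowRank A₁ B₁ = m₁) ∧
      -- (b)
      ((∀ X : Matrix (Fin n) (Fin n) ℂ, X.IsHermitian → (B₂ * X * B₂ᴴ - A₂).PosSemidef →
          IsUnit (A₁ - B₁ * X * B₁ᴴ)) ↔
        rowRank A₁ B₁ = m₁ ∧
        (negInertia (matM A₁ A₂ B₁ B₂) : ℤ) =
          negInertia (bordered A₁ B₁) + (matN A₁ B₁ B₂).rank - m₁) ∧
      -- (c)
      ((∃ X : Matrix (Fin n) (Fin n) ℂ, X.IsHermitian ∧ B₁ * X * B₁ᴴ = A₁ ∧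
          (B₂ * X * B₂ᴴ - A₂).PosSemidef) ↔
        colSpace A₁ ≤ colSpace B₁ ∧ negInertia (matM A₁ A₂ B₁ B₂) = colRank B₁ B₂) ∧
      -- (d)
      ((∃ X : Matrix (Fin n) (Fin n) ℂ, X.IsHermitian ∧ (A₁ - B₁ * X * B₁ᴴ).PosDef ∧
          (B₂ * X * B₂ᴴ - A₂).PosSemidef) ↔
        posInertia (matM A₁ A₂ B₁ B₂) = rowRank A₂ B₂ + m₁) ∧
      -- (e)
      ((∃ X : Matrix (Fin n) (Fin n) ℂ, X.IsHermitian ∧ (B₁ * X * B₁ᴴ - A₁).PosDef ∧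
          (B₂ * X * B₂ᴴ - A₂).PosSemidef) ↔
        negInertia (bordered A₁ B₁) = m₁) ∧
      -- (f)
      ((∃ X : Matrix (Fin n) (Fin n) ℂ, X.IsHermitian ∧ (A₁ - B₁ * X * B₁ᴴ).PosSemidef ∧
          (B₂ * X * B₂ᴴ - A₂).PosSemidef) ↔
        (negInertia (matM A₁ A₂ B₁ B₂) : ℤ) = (matN A₁ B₁ B₂).rank - rowRank A₁ B₁) ∧
      -- (g)
      ((∃ X : Matrix (Fin n) (Fin n) ℂ, X.IsHermitian ∧ (B₁ * X * B₁ᴴ - A₁).PosSemidef ∧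
          (B₂ * X * B₂ᴴ - A₂).PosSemidef) ↔
        negInertia (bordered A₁ B₁) = rowRank A₁ B₁) ∧
      -- (h)
      (lmiSol A₂ B₂ ⊆ lmiSol A₁ B₁ ↔
        posInertia (matM A₁ A₂ B₁ B₂) = rowRank A₂ B₂) ∧
      -- (i)
      ((∀ X ∈ lmiSol A₂ B₂, ∀ Y ∈ lmiSol A₂ B₂,
          (resid A₁ B₁ X).rank = (resid A₁ B₁ Y).rank) ↔
        (negInertia (matM A₁ A₂ B₁ B₂) : ℤ) =
          negInertia (bordered A₁ B₁) + (matN A₁ B₁ B₂).rank - rowRank A₁ B₁) ∧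
      -- (j)
      ((∀ X ∈ lmiSol A₂ B₂, ∀ Y ∈ lmiSol A₂ B₂,
          posInertia (resid A₁ B₁ X) = posInertia (resid A₁ B₁ Y)) ↔
        posInertia (matM A₁ A₂ B₁ B₂) + negInertia (bordered A₁ B₁) =
          rowRank A₁ B₁ + rowRank A₂ B₂) ∧
      -- (k)
      ((∀ X ∈ lmiSol A₂ B₂, ∀ Y ∈ lmiSol A₂ B₂,
          negInertia (resid A₁ B₁ X) = negInertia (resid A₁ B₁ Y)) ↔
        negInertia (bordered A₁ B₁) + (matN A₁ B₁ B₂).rank =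
          rowRank A₁ B₁ + negInertia (matM A₁ A₂ B₁ B₂)) ∧
      -- (l)
      ((∃ X : Matrix (Fin n) (Fin n) ℂ, X.IsHermitian ∧ B₁ * X * B₁ᴴ = A₁) ↔
        colSpace A₁ ≤ colSpace B₁) ∧
      ((∃ X : Matrix (Fin n) (Fin n) ℂ, X.IsHermitian ∧ B₂ * X * B₂ᴴ = A₂) ↔
        colSpace A₂ ≤ colSpace B₂) ∧
      ((∃ X₁ : Matrix (Fin n) (Fin n) ℂ, X₁.IsHermitian ∧ B₁ * X₁ * B₁ᴴ = A₁) →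
        (∃ X₂ : Matrix (Fin n) (Fin n) ℂ, X₂.IsHermitian ∧ B₂ * X₂ * B₂ᴴ = A₂) →
        IsMaxVal (lmiSol A₂ B₂) (fun X => (resid A₁ B₁ X).rank) B₁.rank ∧
        IsMinVal (lmiSol A₂ B₂) (fun X => (resid A₁ B₁ X).rank)
          ((negInertia (matM A₁ A₂ B₁ B₂) : ℤ) - colRank B₁ B₂) ∧
        IsMaxVal (lmiSol A₂ B₂) (fun X => posInertia (resid A₁ B₁ X))
          ((posInertia (matM A₁ A₂ B₁ B₂) : ℤ) - B₂.rank) ∧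
        IsMinVal (lmiSol A₂ B₂) (fun X => posInertia (resid A₁ B₁ X)) 0 ∧
        IsMaxVal (lmiSol A₂ B₂) (fun X => negInertia (resid A₁ B₁ X)) B₁.rank ∧
        IsMinVal (lmiSol A₂ B₂) (fun X => negInertia (resid A₁ B₁ X))
          ((negInertia (matM A₁ A₂ B₁ B₂) : ℤ) - colRank B₁ B₂))) := by
  refine ⟨lmiSol_nonempty_iff B₂ hA₂, fun hne => ?_⟩
  -- bounds valid for every solution
  have hsum : ∀ X : Matrix (Fin n) (Fin n) ℂ, X.IsHermitian →
      posInertia (resid A₁ B₁ X) + negInertia (resid A₁ B₁ X) = (resid A₁ B₁ X).rank :=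
    fun X hX => posInertia_add_negInertia (isHermitian_resid hA₁ B₁ hX)
  have hrank : ∀ X, (resid A₁ B₁ X).rank ≤ rowRank A₁ B₁ := fun X => rank_resid_le A₁ B₁ X
  have hneg : ∀ X : Matrix (Fin n) (Fin n) ℂ, X.IsHermitian →
      negInertia (resid A₁ B₁ X) ≤ negInertia (bordered A₁ B₁) :=
    fun X hX => negInertia_resid_le hA₁ B₁ hX
  have hpos : ∀ X : Matrix (Fin n) (Fin n) ℂ, X.IsHermitian →
      rowRank A₁ B₁ ≤ posInertia (resid A₁ B₁ X) + negInertia (bordered A₁ B₁) :=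
    fun X hX => rank_fromCols_le hA₁ B₁ hX
  have hposM := fun X (hX : X ∈ lmiSol A₂ B₂) => posInertia_resid_add_le B₁ B₂ hA₁ hA₂ hX
  have hnegM := fun X (hX : X ∈ lmiSol A₂ B₂) => negInertia_matM_add_le B₁ B₂ hA₁ hA₂ hX
  -- solutions attaining the bounds
  obtain ⟨Xa, hXa, ha₁, ha₂⟩ := exists_max_pos_min_neg B₁ B₂ hA₁ hA₂ hne
  obtain ⟨Xb, hXb, hb⟩ := exists_max_neg B₁ B₂ hA₁ hne
  obtain ⟨Xc, hXc, hc⟩ := exists_min_rank B₁ B₂ hA₁ hA₂ hne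
  have hall : ∀ X ∈ lmiSol A₂ B₂,
      posInertia (resid A₁ B₁ X) + negInertia (resid A₁ B₁ X) = (resid A₁ B₁ X).rank ∧
      (resid A₁ B₁ X).rank ≤ rowRank A₁ B₁ ∧
      negInertia (resid A₁ B₁ X) ≤ negInertia (bordered A₁ B₁) ∧
      rowRank A₁ B₁ ≤ posInertia (resid A₁ B₁ X) + negInertia (bordered A₁ B₁) ∧
      posInertia (resid A₁ B₁ X) + rowRank A₂ B₂ ≤ posInertia (matM A₁ A₂ B₁ B₂) ∧
      negInertia (matM A₁ A₂ B₁ B₂) + rowRank A₁ B₁ ≤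
        negInertia (resid A₁ B₁ X) + (matN A₁ B₁ B₂).rank := fun X hX =>
    ⟨hsum X hX.1, hrank X, hneg X hX.1, hpos X hX.1, hposM X hX, hnegM X hX⟩
  have hla := hall Xa hXa
  have hlb := hall Xb hXb
  have hlc := hall Xc hXc
  -- At Xb the rank equals r[A₁,B₁], so this also gives r[A₁,B₁] ≤ m₁, as used for nonsingularity.
  have hm₁ : (resid A₁ B₁ Xb).rank ≤ m₁ := by simpa using (resid A₁ B₁ Xb).rank_le_card_width
  have hmax : ∀ (f : Matrix (Fin n) (Fin n) ℂ → ℕ) (v : ℤ) (Y : Matrix (Fin n) (Fin n) ℂ),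
      Y ∈ lmiSol A₂ B₂ → (f Y : ℤ) = v → (∀ X ∈ lmiSol A₂ B₂, (f X : ℤ) ≤ v) →
      IsMaxVal (lmiSol A₂ B₂) f v := fun f v Y hY hv h =>
    ⟨⟨Y, hY, hv⟩, by rintro _ ⟨X, hX, rfl⟩; exact h X hX⟩
  have hmin : ∀ (f : Matrix (Fin n) (Fin n) ℂ → ℕ) (v : ℤ) (Y : Matrix (Fin n) (Fin n) ℂ),
      Y ∈ lmiSol A₂ B₂ → (f Y : ℤ) = v → (∀ X ∈ lmiSol A₂ B₂, v ≤ (f X : ℤ)) →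
      IsMinVal (lmiSol A₂ B₂) f v := fun f v Y hY hv h =>
    ⟨⟨Y, hY, hv⟩, by rintro _ ⟨X, hX, rfl⟩; exact h X hX⟩
  -- definiteness and rank of the residual in terms of its inertia
  have hpsd : ∀ X : Matrix (Fin n) (Fin n) ℂ, X.IsHermitian →
      ((A₁ - B₁ * X * B₁ᴴ).PosSemidef ↔ negInertia (resid A₁ B₁ X) = 0) := fun X hX =>
    (negInertia_eq_zero_iff (isHermitian_resid hA₁ B₁ hX)).symm
  have hnsd : ∀ X : Matrix (Fin n) (Fin n) ℂ, X.IsHermitian →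
      ((B₁ * X * B₁ᴴ - A₁).PosSemidef ↔ posInertia (resid A₁ B₁ X) = 0) := fun X hX =>
    posSemidef_resid_iff B₁ hA₁ hX
  have hpd : ∀ X : Matrix (Fin n) (Fin n) ℂ, X.IsHermitian →
      ((A₁ - B₁ * X * B₁ᴴ).PosDef ↔ posInertia (resid A₁ B₁ X) = m₁) := fun X hX => by
    rw [← posInertia_eq_card_iff (isHermitian_resid hA₁ B₁ hX), Fintype.card_fin]; rfl
  have hnd : ∀ X : Matrix (Fin n) (Fin n) ℂ, X.IsHermitian →
      ((B₁ * X * B₁ᴴ - A₁).PosDef ↔ negInertia (resid A₁ B₁ X) = m₁) := fun X hX => by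
    rw [← neg_sub, ← negInertia_eq_card_iff (isHermitian_resid hA₁ B₁ hX), Fintype.card_fin]; rfl
  have hunit : ∀ X : Matrix (Fin n) (Fin n) ℂ,
      IsUnit (A₁ - B₁ * X * B₁ᴴ) ↔ (resid A₁ B₁ X).rank = m₁ := fun X => by
    rw [← rank_eq_card_iff_isUnit, Fintype.card_fin]; rfl
  have hzero : ∀ X : Matrix (Fin n) (Fin n) ℂ,
      B₁ * X * B₁ᴴ = A₁ ↔ (resid A₁ B₁ X).rank = 0 := fun X => by
    rw [matrix_rank_eq_zero_iff, resid, sub_eq_zero, eq_comm]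
  -- values in the consistent case
  have hcons : ∀ X : Matrix (Fin n) (Fin n) ℂ, X.IsHermitian → B₁ * X * B₁ᴴ = A₁ →
      rowRank A₁ B₁ = B₁.rank ∧ negInertia (bordered A₁ B₁) = B₁.rank ∧
      (matN A₁ B₁ B₂).rank = B₁.rank + colRank B₁ B₂ := fun X hX h => by
    have h1 := rowRank_eq_rank B₁ h
    have h2 := (hzero X).1 h
    have h3 := hsum X hX
    have h4 := hpos X hX
    -- The zero residual gives i₋(M₁) ≥ r[A₁,B₁]; the reverse inequality comes from Xb, where i₋(M₁)
    -- ≤ i₋(R) ≤ r[A₁,B₁].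
    exact ⟨h1, by omega, rank_matN_eq B₁ B₂ hA₁ h⟩
  refine ⟨?_, ?_, ?_, ?_, ?_, ?_, ?_, ?_, ?_, ?_, ?_, ?_, ?_, ?_, ?_, ?_, ?_,
    exists_resid_eq_zero_iff B₁ hA₁, exists_resid_eq_zero_iff B₂ hA₂, ?_⟩
  · refine hmax _ _ Xb hXb (by omega) fun X hX => ?_
    have := hall X hX
    omega
  · refine hmin _ _ Xc hXc (by omega) fun X hX => ?_
    have := hall X hX
    omega
  · refine hmax _ _ Xa hXa (by omega) fun X hX => ?_
    have := hall X hX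
    omega
  · refine hmin _ _ Xb hXb (by omega) fun X hX => ?_
    have := hall X hX
    omega
  · refine hmax _ _ Xb hXb (by omega) fun X hX => ?_
    have := hall X hX
    omega
  · refine hmin _ _ Xa hXa (by omega) fun X hX => ?_
    have := hall X hX
    omega
  · constructor
    · rintro ⟨X, hX, hu, hP⟩
      rw [hunit] at hu
      have := hall X ⟨hX, hP⟩
      omega
    · intro h
      exact ⟨Xb, hXb.1, (hunit _).2 (by omega), hXb.2⟩
  · constructor
    · intro h
      have h1 := (hunit _).1 (h Xb hXb.1 hXb.2)
      have h2 := (hunit _).1 (h Xc hXc.1 hXc.2)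
      omega
    · rintro ⟨h1, h2⟩ X hX hP
      have := hall X ⟨hX, hP⟩
      exact (hunit X).2 (by omega)
  · constructor
    · rintro ⟨X, hX, h, hP⟩
      have h1 := hcons X hX h
      have h2 := hall X ⟨hX, hP⟩
      have h3 := (hzero X).1 h
      exact ⟨(exists_resid_eq_zero_iff B₁ hA₁).1 ⟨X, hX, h⟩, by omega⟩
    · rintro ⟨h, hM⟩
      obtain ⟨X, hX, h⟩ := (exists_resid_eq_zero_iff B₁ hA₁).2 h
      have h1 := hcons X hX h
      exact ⟨Xc, hXc.1, (hzero _).2 (by omega), hXc.2⟩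
  · constructor
    · rintro ⟨X, hX, h, hP⟩
      rw [hpd X hX] at h
      have := hall X ⟨hX, hP⟩
      have : posInertia (resid A₁ B₁ Xa) ≤ m₁ := by
        have := (resid A₁ B₁ Xa).rank_le_card_width
        rw [Fintype.card_fin] at this
        omega
      omega
    · intro h
      exact ⟨Xa, hXa.1, (hpd Xa hXa.1).2 (by omega), hXa.2⟩
  · constructor
    · rintro ⟨X, hX, h, hP⟩
      rw [hnd X hX] at h
      have := hall X ⟨hX, hP⟩
      omega
    · intro h
      exact ⟨Xb, hXb.1, (hnd Xb hXb.1).2 (by omega), hXb.2⟩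
  · constructor
    · rintro ⟨X, hX, h, hP⟩
      rw [hpsd X hX] at h
      have := hall X ⟨hX, hP⟩
      omega
    · intro h
      exact ⟨Xa, hXa.1, (hpsd Xa hXa.1).2 (by omega), hXa.2⟩
  · constructor
    · rintro ⟨X, hX, h, hP⟩
      rw [hnsd X hX] at h
      have := hall X ⟨hX, hP⟩
      omega
    · intro h
      exact ⟨Xb, hXb.1, (hnsd Xb hXb.1).2 (by omega), hXb.2⟩
  · constructor
    · intro h
      have := (hnsd Xa hXa.1).1 (h hXa).2
      omega
    · intro h X hX
      have := hall X hX
      exact ⟨hX.1, (hnsd X hX.1).2 (by omega)⟩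
  · constructor
    · intro h
      have := h Xb hXb Xc hXc
      omega
    · intro h X hX Y hY
      have h1 := hall X hX
      have h2 := hall Y hY
      omega
  · constructor
    · intro h
      have := h Xa hXa Xb hXb
      omega
    · intro h X hX Y hY
      have h1 := hall X hX
      have h2 := hall Y hY
      omega
  · constructor
    · intro h
      have := h Xa hXa Xb hXb
      omega
    · intro h X hX Y hY
      have h1 := hall X hX
      have h2 := hall Y hY
      omega
  · rintro ⟨X₁, hX₁, h₁⟩ ⟨X₂, -, h₂⟩
    have hv₁ := hcons X₁ hX₁ h₁
    have hv₂ := rowRank_eq_rank B₂ h₂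
    refine ⟨hmax _ _ Xb hXb (by omega) fun X hX => ?_, hmin _ _ Xc hXc (by omega) fun X hX => ?_,
      hmax _ _ Xa hXa (by omega) fun X hX => ?_, hmin _ _ Xb hXb (by omega) fun X hX => ?_,
      hmax _ _ Xb hXb (by omega) fun X hX => ?_, hmin _ _ Xa hXa (by omega) fun X hX => ?_⟩
    all_goals
      have := hall X hX
      omega
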